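/- **Notation.** $\mathbb N=\{1,2,\dots\}$, $\mathbb N_0=\mathbb N\cup\{0\}$. Let $s=\{\xi\in\mathbb C^{\mathbb N}: |\xi|_q:=(\sum_j|\xi_j|^2j^{2q})^{1/2}<\infty\ \text{for all } q\in\mathbb N_0\}$ with the topology given by the norms $|\cdot|_q$, and let $s'=\{\xi\in\mathbb C^{\mathbb N}: |\xi|'_q:=(\sum_j|\xi_j|^2j^{-2q})^{1/2}<\infty\ \text{for some } q\in\mathbb N_0\}$ with the locally convex inductive limit topology given by the norms $|\cdot|'_q$. Put $\langle\xi,\eta\rangle=\sum_j\xi_j\overline{\eta_j}$ for $(\xi,\eta)\in (s\times s')\cup(s'\times s)$. Let $\mathcal L(s',s)$ be the space of continuous linear operators $s'\to s$ with the topology of uniform convergence on bounded sets, with multiplication $xy=x\circ j\circ y$, where $j\colon s\hookrightarrow s'$ is the inclusion, and with the involution $x\mapsto x^*$ determined by $\langle x\xi,\eta\rangle=\langle \xi,x^*\eta\rangle$ (the hermitian adjoint on $\ell_2$). A sequence $(f_k)_{k\in\mathbb N}\subset s$ is orthonormal if $\langle f_k,f_l\rangle=\delta_{kl}$ for all $k,l$.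 For such a sequence let $\lambda^\infty(|f_k|_q)=\{\xi\in\mathbb C^{\mathbb N}:\sup_k|\xi_k|\,|f_k|_q<\infty\ \text{for all } q\in\mathbb N_0\}$ with the topology given by these seminorms and with pointwise multiplication and complex conjugation; $e_k$ denotes the $k$-th unit vector. An isomorphism of Fréchet ${}^*$-algebras is a ${}^*$-algebra isomorphism which is a homeomorphism. A projection is an element $P$ with $P=P^2=P^*$. The canonical Schauder basis of a closed commutative ${}^*$-subalgebra $E$ of $\mathcal L(s',s)$ consists of all minimal nonzero projections in $E$, i.e. of those nonzero projections $P\in E$ such that $Q=P$ for every nonzero projection $Q\in E$ with $QP=Q$. **Theorem.** (1) Every closed commutative ${}^*$-subalgebra of $\mathcal L(s',s)$ is isomorphic as a Fréchet ${}^*$-algebra to some closed ${}^*$-subalgebra of $\lambda^\infty(|f_k|_q)$ for some orthonormal sequence $(f_k)_{k\in\mathbb N}\subset s$. (2) More precisely, let $E$ be an infinite-dimensional closed commutative ${}^*$-subalgebra of $\mathcal L(s',s)$ whose canonical Schauder basis is $(\sum_{j\in\mathcal N_k}\langle\cdot,f_j\rangle f_j)_{k\in\mathbb N}$ (listed without repetition)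 for some family $(\mathcal N_k)_{k\in\mathbb N}$ of finite pairwise disjoint subsets of $\mathbb N$ and some orthonormal sequence $(f_j)_{j\in\mathbb N}\subset s$. Then there is an isomorphism of Fréchet ${}^*$-algebras from $E$ onto the closed ${}^*$-subalgebra of $\lambda^\infty(|f_k|_q)$ generated by $\{\sum_{j\in\mathcal N_k}e_j\}_{k\in\mathbb N}$ that maps $\sum_{j\in\mathcal N_k}\langle\cdot,f_j\rangle f_j$ to $\sum_{j\in\mathcal N_k}e_j$ for every $k\in\mathbb N$. (3) Conversely, if $(f_k)_{k\in\mathbb N}\subset s$ is an orthonormal sequence, then every closed ${}^*$-subalgebra of $\lambda^\infty(|f_k|_q)$ is isomorphic as a Fréchet ${}^*$-algebra to some closed commutative ${}^*$-subalgebra of $\mathcal L(s',s)$. -/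

import Mathlib

open scoped ComplexConjugate

noncomputable section

namespace SmoothOp

/-! ### Weighted `ℓ₂`-norms of complex sequences

Sequences are indexed by `ℕ = {0, 1, 2, …}`, so the weight of the `j`-th coordinate is `j + 1`. -/

/-- `∑ⱼ |ξⱼ|² (j+1)^{2p} < ∞`, for an integer exponent `p`. -/
def WMem (p : ℤ) (ξ : ℕ → ℂ) : Prop :=
  Summable fun j : ℕ => ‖ξ j‖ ^ 2 * ((j : ℝ) + 1) ^ (2 * p)

/-- `(∑ⱼ |ξⱼ|² (j+1)^{2p})^{1/2}`, for an integer exponent `p`. -/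
def wnorm (p : ℤ) (ξ : ℕ → ℂ) : ℝ :=
  √(∑' j : ℕ, ‖ξ j‖ ^ 2 * ((j : ℝ) + 1) ^ (2 * p))

/-- The pairing `⟨ξ, η⟩ = ∑ⱼ ξⱼ conj(ηⱼ)`. -/
def pairing (ξ η : ℕ → ℂ) : ℂ := ∑' j : ℕ, ξ j * conj (η j)

/-- The sequence `ξ` multiplied by the weight `(j+1)^p`. -/
def wseq (p : ℤ) (ξ : ℕ → ℂ) : ℕ → ℂ := fun j => ξ j * ((((j : ℝ) + 1) ^ p : ℝ) : ℂ)

theorem weight_pos (j : ℕ) : (0 : ℝ) < (j : ℝ) + 1 := by positivity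

theorem norm_wseq_sq (p : ℤ) (ξ : ℕ → ℂ) (j : ℕ) :
    ‖wseq p ξ j‖ ^ 2 = ‖ξ j‖ ^ 2 * ((j : ℝ) + 1) ^ (2 * p) := by
  have h := zpow_pos (weight_pos j) p
  rw [wseq, norm_mul, Complex.norm_real, Real.norm_of_nonneg h.le, mul_pow, mul_comm 2 p,
    zpow_mul]
  norm_cast

theorem wmem_iff (p : ℤ) (ξ : ℕ → ℂ) : WMem p ξ ↔ Memℓp (wseq p ξ) 2 := by
  rw [memℓp_gen_iff (by norm_num)]
  simp only [WMem, ENNReal.toReal_ofNat, Real.rpow_ofNat, norm_wseq_sq]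

theorem wnorm_eq {p : ℤ} {ξ : ℕ → ℂ} (h : WMem p ξ) :
    wnorm p ξ = ‖(⟨wseq p ξ, (wmem_iff p ξ).1 h⟩ : lp (fun _ : ℕ => ℂ) 2)‖ := by
  rw [lp.norm_eq_tsum_rpow (by norm_num), wnorm, Real.sqrt_eq_rpow]
  simp only [ENNReal.toReal_ofNat, Real.rpow_ofNat, norm_wseq_sq]

theorem wseq_add (p : ℤ) (ξ η : ℕ → ℂ) : wseq p (ξ + η) = wseq p ξ + wseq p η := by
  funext j; simp [wseq, add_mul]

theorem wseq_smul (p : ℤ) (c : ℂ) (ξ : ℕ → ℂ) : wseq p (c • ξ) = c • wseq p ξ := by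
  funext j; simp [wseq, mul_assoc]

theorem WMem.zero (p : ℤ) : WMem p 0 := by
  simp [WMem, summable_zero]

theorem WMem.add {p : ℤ} {ξ η : ℕ → ℂ} (hξ : WMem p ξ) (hη : WMem p η) : WMem p (ξ + η) := by
  rw [wmem_iff] at *
  rw [wseq_add]
  exact hξ.add hη

theorem WMem.smul {p : ℤ} {ξ : ℕ → ℂ} (c : ℂ) (hξ : WMem p ξ) : WMem p (c • ξ) := by
  rw [wmem_iff] at *
  rw [wseq_smul]
  exact hξ.const_smul c

theorem wnorm_nonneg (p : ℤ) (ξ : ℕ → ℂ) : 0 ≤ wnorm p ξ := Real.sqrt_nonneg _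

theorem wnorm_add_le {p : ℤ} {ξ η : ℕ → ℂ} (hξ : WMem p ξ) (hη : WMem p η) :
    wnorm p (ξ + η) ≤ wnorm p ξ + wnorm p η := by
  rw [wnorm_eq hξ, wnorm_eq hη, wnorm_eq (hξ.add hη)]
  refine le_trans (le_of_eq ?_) (norm_add_le _ _)
  congr 1
  exact Subtype.ext (wseq_add p ξ η)

theorem wnorm_smul (p : ℤ) (c : ℂ) (ξ : ℕ → ℂ) : wnorm p (c • ξ) = ‖c‖ * wnorm p ξ := by
  have : ∀ j : ℕ, ‖(c • ξ) j‖ ^ 2 * ((j : ℝ) + 1) ^ (2 * p)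
      = ‖c‖ ^ 2 * (‖ξ j‖ ^ 2 * ((j : ℝ) + 1) ^ (2 * p)) := fun j => by
    rw [Pi.smul_apply, smul_eq_mul, norm_mul]; ring
  simp only [wnorm, this, tsum_mul_left]
  rw [Real.sqrt_mul (by positivity), Real.sqrt_sq (norm_nonneg c)]

theorem weight_mono {p q : ℤ} (hpq : p ≤ q) (j : ℕ) :
    ((j : ℝ) + 1) ^ (2 * p) ≤ ((j : ℝ) + 1) ^ (2 * q) :=
  zpow_le_zpow_right₀ (by simp) (by lia)

theorem WMem.mono {p q : ℤ} (hpq : p ≤ q) {ξ : ℕ → ℂ} (h : WMem q ξ) : WMem p ξ := by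
  refine Summable.of_nonneg_of_le (fun j => ?_) (fun j => ?_) h
  · have := zpow_pos (weight_pos j) (2 * p); positivity
  · exact mul_le_mul_of_nonneg_left (weight_mono hpq j) (by positivity)

theorem wnorm_mono {p q : ℤ} (hpq : p ≤ q) {ξ : ℕ → ℂ} (h : WMem q ξ) :
    wnorm p ξ ≤ wnorm q ξ :=
  Real.sqrt_le_sqrt ((h.mono hpq).tsum_le_tsum
    (fun j => mul_le_mul_of_nonneg_left (weight_mono hpq j) (by positivity)) h)

theorem norm_apply_le {p : ℤ} {ξ : ℕ → ℂ} (h : WMem p ξ) (j : ℕ) :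
    ‖ξ j‖ * ((j : ℝ) + 1) ^ p ≤ wnorm p ξ := by
  have h1 := lp.norm_apply_le_norm (p := 2) (by norm_num)
    (⟨wseq p ξ, (wmem_iff p ξ).1 h⟩ : lp (fun _ : ℕ => ℂ) 2) j
  rw [← wnorm_eq h] at h1
  refine le_trans (le_of_eq ?_) h1
  change _ = ‖wseq p ξ j‖
  rw [wseq, norm_mul, Complex.norm_real, Real.norm_of_nonneg (zpow_pos (weight_pos j) p).le]

theorem wseq_mul_conj (p : ℤ) (ξ η : ℕ → ℂ) (j : ℕ) :
    wseq p ξ j * conj (wseq (-p) η j) = ξ j * conj (η j) := by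
  have h : (((((j : ℝ) + 1) ^ p : ℝ) : ℂ)) ≠ 0 := by
    exact_mod_cast (zpow_pos (weight_pos j) p).ne'
  simp only [wseq, map_mul, Complex.conj_ofReal]
  rw [zpow_neg, Complex.ofReal_inv]
  field_simp

theorem pairing_summable {p : ℤ} {ξ η : ℕ → ℂ} (hξ : WMem p ξ) (hη : WMem (-p) η) :
    Summable fun j => ξ j * conj (η j) := by
  have := lp.summable_inner (𝕜 := ℂ)
    (⟨wseq (-p) η, (wmem_iff _ η).1 hη⟩ : lp (fun _ : ℕ => ℂ) 2)
    (⟨wseq p ξ, (wmem_iff _ ξ).1 hξ⟩ : lp (fun _ : ℕ => ℂ) 2)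
  refine this.congr fun j => ?_
  rw [← wseq_mul_conj p ξ η j]
  rfl

theorem norm_pairing_le {p : ℤ} {ξ η : ℕ → ℂ} (hξ : WMem p ξ) (hη : WMem (-p) η) :
    ‖pairing ξ η‖ ≤ wnorm p ξ * wnorm (-p) η := by
  have := norm_inner_le_norm (𝕜 := ℂ)
    (⟨wseq (-p) η, (wmem_iff _ η).1 hη⟩ : lp (fun _ : ℕ => ℂ) 2)
    (⟨wseq p ξ, (wmem_iff _ ξ).1 hξ⟩ : lp (fun _ : ℕ => ℂ) 2)
  rw [lp.inner_eq_tsum, ← wnorm_eq hξ, ← wnorm_eq hη, mul_comm] at this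
  refine le_trans (le_of_eq ?_) this
  congr 1
  refine tsum_congr fun j => ?_
  rw [← wseq_mul_conj p ξ η j]
  rfl

theorem wmem_single (p : ℤ) (j : ℕ) : WMem p (Pi.single j 1) := by
  refine summable_of_ne_finset_zero (s := {j}) fun b hb => ?_
  rw [Pi.single_eq_of_ne (by simpa using hb)]
  simp

theorem wnorm_single (p : ℤ) (j : ℕ) : wnorm p (Pi.single j 1) = ((j : ℝ) + 1) ^ p := by
  rw [wnorm, tsum_eq_single j fun b hb => by rw [Pi.single_eq_of_ne hb]; simp]
  rw [Pi.single_eq_same, norm_one, one_pow, one_mul, mul_comm, zpow_mul]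
  exact Real.sqrt_sq (zpow_pos (weight_pos j) p).le

theorem pairing_single_right (ξ : ℕ → ℂ) (j : ℕ) : pairing ξ (Pi.single j 1) = ξ j := by
  rw [pairing, tsum_eq_single j fun b hb => by rw [Pi.single_eq_of_ne hb]; simp]
  simp

theorem pairing_conj (ξ η : ℕ → ℂ) : conj (pairing ξ η) = pairing η ξ := by
  rw [pairing, Complex.conj_tsum]
  exact tsum_congr fun j => by simp [mul_comm]

/-! ### The Fréchet space `s` of rapidly decreasing sequences -/

/-- The sequences `ξ` with `|ξ|_q < ∞` for all `q ∈ ℕ₀`. -/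
def sSubmodule : Submodule ℂ (ℕ → ℂ) where
  carrier := {ξ | ∀ q : ℕ, WMem q ξ}
  zero_mem' := fun q => WMem.zero q
  add_mem' := fun hξ hη q => (hξ q).add (hη q)
  smul_mem' := fun c _ hξ q => (hξ q).smul c

/-- The space `s`; a type of its own, so that it does not carry the topology of `ℂ^ℕ`. -/
def S : Type := sSubmodule

instance : AddCommGroup S := inferInstanceAs (AddCommGroup sSubmodule)
instance : Module ℂ S := inferInstanceAs (Module ℂ sSubmodule)

/-- The sequence of coordinates of an element of `s`. -/
def S.toSeq : S →ₗ[ℂ] (ℕ → ℂ) := sSubmodule.subtype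

instance : CoeFun S fun _ => ℕ → ℂ := ⟨fun ξ => S.toSeq ξ⟩

/-- The element of `s` with given coordinates. -/
def S.mk (ξ : ℕ → ℂ) (h : ∀ q : ℕ, WMem q ξ) : S := (⟨ξ, h⟩ : sSubmodule)

theorem S.toSeq_mk (ξ : ℕ → ℂ) (h : ∀ q : ℕ, WMem q ξ) : S.toSeq (S.mk ξ h) = ξ := rfl
theorem S.ext {ξ η : S} (h : ∀ j, ξ j = η j) : ξ = η := Subtype.ext (funext h)
theorem S.wmem_nat (ξ : S) (q : ℕ) : WMem q ξ := Subtype.prop (p := (· ∈ sSubmodule)) ξ q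
theorem S.wmem (ξ : S) (p : ℤ) : WMem p ξ := (ξ.wmem_nat p.toNat).mono (Int.self_le_toNat p)

/-- The norm `|ξ|_q = (∑ⱼ |ξⱼ|² (j+1)^{2q})^{1/2}` on `s`. -/
def sNorm : SeminormFamily ℂ S ℕ := fun q =>
  Seminorm.of (fun ξ => wnorm q ξ)
    (fun ξ η => by rw [map_add]; exact wnorm_add_le (ξ.wmem q) (η.wmem q))
    (fun c ξ => by rw [map_smul]; exact wnorm_smul q c ξ)

theorem sNorm_apply (q : ℕ) (ξ : S) : sNorm q ξ = wnorm q ξ := rfl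

/-- The topology of `s` is given by the norms `|·|_q`. -/
instance : TopologicalSpace S := sNorm.moduleFilterBasis.topology

theorem S.withSeminorms : WithSeminorms sNorm := ⟨rfl⟩

instance : IsTopologicalAddGroup S := S.withSeminorms.topologicalAddGroup
instance : ContinuousSMul ℂ S := S.withSeminorms.continuousSMul

/-! ### The dual `s'`: slowly increasing sequences with the inductive limit topology -/

/-- The sequences `ξ` with `|ξ|'_q < ∞` for some `q ∈ ℕ₀`. -/
def sDualSubmodule : Submodule ℂ (ℕ → ℂ) where
  carrier := {ξ | ∃ q : ℕ, WMem (-q) ξ}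
  zero_mem' := ⟨0, WMem.zero _⟩
  add_mem' := by
    rintro ξ η ⟨q, hξ⟩ ⟨r, hη⟩
    exact ⟨max q r, (hξ.mono (by simp)).add (hη.mono (by simp))⟩
  smul_mem' := by
    rintro c ξ ⟨q, hξ⟩
    exact ⟨q, hξ.smul c⟩

/-- The space `s'`; a type of its own, so that it does not carry the topology of `ℂ^ℕ`. -/
def SDual : Type := sDualSubmodule

instance : AddCommGroup SDual := inferInstanceAs (AddCommGroup sDualSubmodule)
instance : Module ℂ SDual := inferInstanceAs (Module ℂ sDualSubmodule)

/-- The sequence of coordinates of an element of `s'`. -/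
def SDual.toSeq : SDual →ₗ[ℂ] (ℕ → ℂ) := sDualSubmodule.subtype

instance : CoeFun SDual fun _ => ℕ → ℂ := ⟨fun ξ => SDual.toSeq ξ⟩

/-- The element of `s'` with given coordinates. -/
def SDual.mk (ξ : ℕ → ℂ) (h : ∃ q : ℕ, WMem (-q) ξ) : SDual := (⟨ξ, h⟩ : sDualSubmodule)

theorem SDual.toSeq_mk (ξ : ℕ → ℂ) (h : ∃ q : ℕ, WMem (-q) ξ) :
    SDual.toSeq (SDual.mk ξ h) = ξ := rfl
theorem SDual.ext {ξ η : SDual} (h : ∀ j, ξ j = η j) : ξ = η := Subtype.ext (funext h)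
theorem SDual.exists_wmem (ξ : SDual) : ∃ q : ℕ, WMem (-q) ξ :=
  Subtype.prop (p := (· ∈ sDualSubmodule)) ξ

/-- A seminorm on `s'` whose restriction to each step
`{ξ : |ξ|'_q < ∞}` is continuous for the norm `|ξ|'_q = (∑ⱼ |ξⱼ|² (j+1)^{-2q})^{1/2}`. -/
def StepBounded (p : Seminorm ℂ SDual) : Prop :=
  ∀ q : ℕ, ∃ C : ℝ, ∀ ξ : SDual, WMem (-q) ξ → p ξ ≤ C * wnorm (-q) ξ

theorem stepBounded_zero : StepBounded 0 := fun _ => ⟨0, fun _ _ => by simp⟩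

instance : Nonempty {p : Seminorm ℂ SDual // StepBounded p} := ⟨⟨0, stepBounded_zero⟩⟩

/-- All seminorms on `s'` that are continuous on every step. -/
def sDualSeminorms : SeminormFamily ℂ SDual {p : Seminorm ℂ SDual // StepBounded p} :=
  fun p => p.1

/-- The (locally convex) inductive limit topology of the steps `{ξ : |ξ|'_q < ∞}`, that is,
the finest locally convex topology that makes the inclusions of all steps continuous:
it is given by all seminorms whose restriction to every step is continuous. -/
instance : TopologicalSpace SDual := sDualSeminorms.moduleFilterBasis.topology

theorem SDual.withSeminorms : WithSeminorms sDualSeminorms := ⟨rfl⟩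

instance : IsTopologicalAddGroup SDual := SDual.withSeminorms.topologicalAddGroup
instance : ContinuousSMul ℂ SDual := SDual.withSeminorms.continuousSMul

/-- The unit vector `eⱼ`, as an element of `s`. -/
def S.unit (j : ℕ) : S := S.mk (Pi.single j 1) fun q => wmem_single q j

/-- The unit vector `eⱼ`, as an element of `s'`. -/
def SDual.unit (j : ℕ) : SDual := SDual.mk (Pi.single j 1) ⟨0, wmem_single _ j⟩

theorem SDual.toSeq_unit (j : ℕ) : SDual.toSeq (SDual.unit j) = Pi.single j 1 := rfl

/-! ### Continuous operators `s' → s` -/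

theorem stepBounded_comp_iff (T : SDual →ₗ[ℂ] S) :
    Continuous T ↔ ∀ q : ℕ, StepBounded ((sNorm q).comp T) := by
  constructor
  · intro hT q
    obtain ⟨s, C, -, hC⟩ := Seminorm.bound_of_continuous SDual.withSeminorms
      ((sNorm q).comp T) ((S.withSeminorms.continuous_seminorm q).comp hT)
    intro r
    have hs : ∃ D : ℝ, ∀ ξ : SDual, WMem (-r) ξ →
        s.sup sDualSeminorms ξ ≤ D * wnorm (-r) ξ := by
      classical
      clear hC
      induction s using Finset.induction_on with
      | empty => exact ⟨0, fun ξ _ => by simp⟩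
      | insert a s _ ih =>
        obtain ⟨D, hD⟩ := ih
        obtain ⟨D', hD'⟩ := a.2 r
        refine ⟨max D' D, fun ξ hξ => ?_⟩
        rw [Finset.sup_insert, Seminorm.sup_apply]
        refine max_le ((hD' ξ hξ).trans ?_) ((hD ξ hξ).trans ?_)
        · exact mul_le_mul_of_nonneg_right (le_max_left _ _) (wnorm_nonneg _ _)
        · exact mul_le_mul_of_nonneg_right (le_max_right _ _) (wnorm_nonneg _ _)
    obtain ⟨D, hD⟩ := hs
    refine ⟨C * D, fun ξ hξ => (hC ξ).trans ?_⟩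
    rw [smul_apply, NNReal.smul_def, smul_eq_mul, mul_assoc]
    exact mul_le_mul_of_nonneg_left (hD ξ hξ) C.2
  · intro h
    refine WithSeminorms.continuous_of_isBounded SDual.withSeminorms S.withSeminorms T fun q => ?_
    exact ⟨{⟨_, h q⟩}, 1, by simp [sDualSeminorms]⟩

/-- A linear map `s' → s` that is continuous on every step is continuous. -/
def mkCLM (T : SDual →ₗ[ℂ] S)
    (h : ∀ q r : ℕ, ∃ C : ℝ, ∀ ξ : SDual, WMem (-r) ξ → wnorm q (T ξ) ≤ C * wnorm (-r) ξ) :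
    SDual →L[ℂ] S :=
  ⟨T, (stepBounded_comp_iff T).2 h⟩

theorem bound_of_clm (x : SDual →L[ℂ] S) (q r : ℕ) :
    ∃ C : ℝ, 0 ≤ C ∧ ∀ ξ : SDual, WMem (-r) ξ → wnorm q (x ξ) ≤ C * wnorm (-r) ξ := by
  obtain ⟨C, hC⟩ := (stepBounded_comp_iff x.toLinearMap).1 x.continuous q r
  refine ⟨max C 0, le_max_right _ _, fun ξ hξ => (hC ξ hξ).trans ?_⟩
  exact mul_le_mul_of_nonneg_right (le_max_left _ _) (wnorm_nonneg _ _)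

/-- The continuous inclusion `j : s → s'`. -/
def incl : S →L[ℂ] SDual where
  toFun ξ := SDual.mk ξ ⟨0, ξ.wmem _⟩
  map_add' _ _ := rfl
  map_smul' _ _ := rfl
  cont := by
    let T : S →ₗ[ℂ] SDual :=
      { toFun := fun ξ => SDual.mk ξ ⟨0, ξ.wmem _⟩
        map_add' := fun _ _ => rfl
        map_smul' := fun _ _ => rfl }
    refine WithSeminorms.continuous_of_isBounded S.withSeminorms SDual.withSeminorms T fun p => ?_
    obtain ⟨C, hC⟩ := p.2 0
    refine ⟨{0}, C.toNNReal, fun ξ => ?_⟩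
    refine (hC (T ξ) (ξ.wmem _)).trans ?_
    rw [Finset.sup_singleton, smul_apply, NNReal.smul_def, smul_eq_mul]
    exact mul_le_mul_of_nonneg_right (Real.le_coe_toNNReal C) (wnorm_nonneg _ _)

theorem incl_apply (ξ : S) (j : ℕ) : incl ξ j = ξ j := rfl

theorem pairing_summable_ds (η : SDual) (ξ : S) : Summable fun j => η j * conj (ξ j) := by
  obtain ⟨q, hq⟩ := η.exists_wmem
  exact pairing_summable hq (ξ.wmem _)

theorem pairing_add_left (η η' : SDual) (ξ : S) :
    pairing (η + η' : SDual) ξ = pairing η ξ + pairing η' ξ := by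
  rw [pairing, pairing, pairing,
    ← (pairing_summable_ds η ξ).tsum_add (pairing_summable_ds η' ξ)]
  exact tsum_congr fun j => by rw [map_add, Pi.add_apply, add_mul]

theorem pairing_smul_left (c : ℂ) (η : SDual) (ξ : S) :
    pairing (c • η : SDual) ξ = c * pairing η ξ := by
  rw [pairing, pairing, ← tsum_mul_left]
  exact tsum_congr fun j => by rw [map_smul, Pi.smul_apply, smul_eq_mul, mul_assoc]

/-- The rank-one operator `⟨·, f⟩ f : s' → s` for `f ∈ s`. -/
def rankOne (f : S) : SDual →L[ℂ] S :=
  mkCLM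
    { toFun := fun ξ => pairing ξ f • f
      map_add' := fun ξ η => by rw [pairing_add_left, add_smul]
      map_smul' := fun c ξ => by rw [pairing_smul_left, mul_smul]; rfl }
    (fun q r => ⟨wnorm r f * wnorm q f, fun ξ hξ => by
      have h := norm_pairing_le hξ (by simpa using f.wmem r)
      rw [neg_neg] at h
      change wnorm q (S.toSeq (pairing ξ f • f)) ≤ _
      rw [map_smul, wnorm_smul]
      calc _ ≤ (wnorm (-r) ξ * wnorm r f) * wnorm q f :=
            mul_le_mul_of_nonneg_right h (wnorm_nonneg _ _)
        _ = _ := by ring⟩)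

/-! ### Multiplication and involution on `L(s', s)`

`L(s', s)` is `SDual →L[ℂ] S`. Mathlib's topology on this space is the topology of uniform
convergence on bounded sets. -/

/-- `xy = x ∘ j ∘ y`. -/
instance : Mul (SDual →L[ℂ] S) := ⟨fun x y => x.comp (incl.comp y)⟩

theorem mul_apply (x y : SDual →L[ℂ] S) (ξ : SDual) : (x * y) ξ = x (incl (y ξ)) := rfl

theorem L_mul_assoc (x y z : SDual →L[ℂ] S) : x * y * z = x * (y * z) :=
  ContinuousLinearMap.ext fun ξ => by rw [mul_apply, mul_apply, mul_apply, mul_apply]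

theorem L_mul_add (x y z : SDual →L[ℂ] S) : x * (y + z) = x * y + x * z :=
  ContinuousLinearMap.ext fun ξ => by
    rw [mul_apply, add_apply, map_add, map_add, add_apply, mul_apply, mul_apply]

theorem L_add_mul (x y z : SDual →L[ℂ] S) : (x + y) * z = x * z + y * z :=
  ContinuousLinearMap.ext fun ξ => by
    rw [mul_apply, add_apply, add_apply, mul_apply, mul_apply]

theorem L_zero_mul (x : SDual →L[ℂ] S) : 0 * x = 0 :=
  ContinuousLinearMap.ext fun ξ => by rw [mul_apply, zero_apply, zero_apply]

theorem L_mul_zero (x : SDual →L[ℂ] S) : x * 0 = 0 :=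
  ContinuousLinearMap.ext fun ξ => by rw [mul_apply, zero_apply, map_zero, map_zero]

theorem L_smul_mul (c : ℂ) (x y : SDual →L[ℂ] S) : (c • x) * y = c • (x * y) :=
  ContinuousLinearMap.ext fun ξ => by rw [mul_apply, smul_apply, smul_apply, mul_apply]

theorem L_mul_smul (c : ℂ) (x y : SDual →L[ℂ] S) : x * (c • y) = c • (x * y) :=
  ContinuousLinearMap.ext fun ξ => by
    rw [mul_apply, smul_apply, map_smul, map_smul, smul_apply, mul_apply]

instance : NonUnitalRing (SDual →L[ℂ] S) :=
  { (inferInstance : AddCommGroup (SDual →L[ℂ] S)) with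
    mul := (· * ·)
    left_distrib := L_mul_add
    right_distrib := L_add_mul
    zero_mul := L_zero_mul
    mul_zero := L_mul_zero
    mul_assoc := L_mul_assoc }

instance : IsScalarTower ℂ (SDual →L[ℂ] S) (SDual →L[ℂ] S) := ⟨L_smul_mul⟩

instance : SMulCommClass ℂ (SDual →L[ℂ] S) (SDual →L[ℂ] S) :=
  ⟨fun c x y => (L_mul_smul c x y).symm⟩

theorem functional_eq_zero (q : ℕ) (φ : SDual →ₗ[ℂ] ℂ) (C : ℝ)
    (hφ : ∀ ξ : SDual, WMem (-q) ξ → ‖φ ξ‖ ≤ C * wnorm (-q) ξ)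
    (h0 : ∀ j, φ (SDual.unit j) = 0) (ξ : SDual) (hξ : WMem (-q) ξ) : φ ξ = 0 := by
  have key : ∀ g : ℕ → ℂ, wseq (-q) (wseq q g) = g := fun g => by
    funext j
    have h : (((((j : ℝ) + 1) ^ (q : ℤ) : ℝ) : ℂ)) ≠ 0 := by
      exact_mod_cast (zpow_pos (weight_pos j) (q : ℤ)).ne'
    simp only [wseq]
    rw [zpow_neg, Complex.ofReal_inv]
    field_simp
  have hm : ∀ g : lp (fun _ : ℕ => ℂ) 2, WMem (-q) (wseq q g) := fun g => by
    rw [wmem_iff, key]; exact g.2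
  let L : lp (fun _ : ℕ => ℂ) 2 →ₗ[ℂ] SDual :=
    { toFun := fun g => SDual.mk (wseq q g) ⟨q, hm g⟩
      map_add' := fun g h => Subtype.ext (wseq_add q g h)
      map_smul' := fun c g => Subtype.ext (wseq_smul q c g) }
  have hL : ∀ g, wnorm (-q) (L g) = ‖g‖ := fun g => by
    change wnorm (-q) (wseq q g) = ‖g‖
    rw [wnorm_eq (hm g)]
    congr 1
    exact Subtype.ext (key g)
  let ψ : lp (fun _ : ℕ => ℂ) 2 →L[ℂ] ℂ := (φ ∘ₗ L).mkContinuous C fun g => by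
    have := hφ (L g) (hm g)
    rwa [hL] at this
  let g : lp (fun _ : ℕ => ℂ) 2 := ⟨wseq (-q) ξ, (wmem_iff _ _).1 hξ⟩
  have hg : L g = ξ := by
    refine SDual.ext fun j => ?_
    have h : (((((j : ℝ) + 1) ^ (q : ℤ) : ℝ) : ℂ)) ≠ 0 := by
      exact_mod_cast (zpow_pos (weight_pos j) (q : ℤ)).ne'
    change wseq q (wseq (-q) ξ) j = ξ j
    simp only [wseq]
    rw [zpow_neg, Complex.ofReal_inv]
    field_simp
  have hs := (lp.hasSum_single (p := 2) (by norm_num) g).mapL ψ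
  have hz : ∀ i, ψ (lp.single 2 i (g i)) = 0 := fun i => by
    change φ (L (lp.single 2 i (g i))) = 0
    have : L (lp.single 2 i (g i))
        = (g i * ((((i : ℝ) + 1) ^ (q : ℤ) : ℝ) : ℂ)) • SDual.unit i := by
      refine SDual.ext fun j => ?_
      change (lp.single 2 i (g i) : ℕ → ℂ) j * _ = _ * (Pi.single i (1 : ℂ) : ℕ → ℂ) j
      by_cases hij : j = i
      · subst hij; simp
      · simp [hij]
    rw [this, map_smul, h0, smul_zero]
  simp only [hz] at hs
  have h1 : ψ g = 0 := hs.unique hasSum_zero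
  have h2 : ψ g = φ ξ := by
    change φ (L g) = φ ξ
    rw [hg]
  rw [← h2, h1]

theorem adjoint_coord_bound (x : SDual →L[ℂ] S) (q r : ℕ) :
    ∃ C : ℝ, 0 ≤ C ∧ ∀ η : SDual, WMem (-r) η → ∀ j : ℕ,
      ‖pairing η (x (SDual.unit j))‖ ^ 2 * ((j : ℝ) + 1) ^ (2 * (q : ℤ))
        ≤ (C * wnorm (-r) η) ^ 2 * (1 / ((j : ℝ) + 1) ^ 2) := by
  obtain ⟨C, hC0, hC⟩ := bound_of_clm x r (q + 1)
  refine ⟨C, hC0, fun η hη j => ?_⟩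
  have h1 := norm_pairing_le hη ((x (SDual.unit j)).wmem _)
  have h2 := hC (SDual.unit j) (wmem_single _ j)
  change _ ≤ C * wnorm _ (Pi.single j 1) at h2
  rw [wnorm_single] at h2
  rw [neg_neg] at h1
  have h3 : ‖pairing η (x (SDual.unit j))‖
      ≤ C * wnorm (-r) η * ((j : ℝ) + 1) ^ (-((q + 1 : ℕ) : ℤ)) := by
    refine h1.trans ((mul_le_mul_of_nonneg_left h2 (wnorm_nonneg _ _)).trans (le_of_eq ?_))
    ring
  have h4 := zpow_pos (weight_pos j) (2 * (q : ℤ))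
  refine (mul_le_mul_of_nonneg_right (pow_le_pow_left₀ (norm_nonneg _) h3 2) h4.le).trans
    (le_of_eq ?_)
  rw [mul_pow, mul_assoc]
  congr 1
  have hj := (weight_pos j).ne'
  rw [← zpow_natCast, ← zpow_mul, ← zpow_add₀ hj, one_div, ← zpow_natCast, ← zpow_neg]
  congr 1
  push_cast
  ring

theorem summable_inv_weight : Summable fun j : ℕ => 1 / ((j : ℝ) + 1) ^ 2 := by
  have := (summable_nat_add_iff 1).2 (Real.summable_one_div_nat_pow.2 (one_lt_two))
  simpa using this

/-- The adjoint `x^*` on `s'`: its `j`-th coordinate is `(x^* η)ⱼ = ⟨η, x eⱼ⟩`. -/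
def adjointLin (x : SDual →L[ℂ] S) : SDual →ₗ[ℂ] S where
  toFun η := S.mk (fun j => pairing η (x (SDual.unit j))) fun q => by
    obtain ⟨r, hr⟩ := η.exists_wmem
    obtain ⟨C, -, hC⟩ := adjoint_coord_bound x q r
    refine Summable.of_nonneg_of_le (fun j => ?_) (fun j => hC η hr j)
      (summable_inv_weight.mul_left _)
    have := zpow_pos (weight_pos j) (2 * (q : ℤ))
    positivity
  map_add' η η' := S.ext fun _ => pairing_add_left _ _ _
  map_smul' c η := S.ext fun _ => pairing_smul_left _ _ _

theorem adjointLin_bound (x : SDual →L[ℂ] S) (q r : ℕ) :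
    ∃ C : ℝ, ∀ η : SDual, WMem (-r) η → wnorm q (adjointLin x η) ≤ C * wnorm (-r) η := by
  obtain ⟨C, hC0, hC⟩ := adjoint_coord_bound x q r
  refine ⟨C * √(∑' j : ℕ, 1 / ((j : ℝ) + 1) ^ 2), fun η hη => ?_⟩
  have h := ((adjointLin x η).wmem q).tsum_le_tsum (hC η hη) (summable_inv_weight.mul_left _)
  rw [tsum_mul_left] at h
  refine (Real.sqrt_le_sqrt h).trans (le_of_eq ?_)
  rw [Real.sqrt_mul (by positivity), Real.sqrt_sq (mul_nonneg hC0 (wnorm_nonneg _ _))]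
  ring

/-- The involution of `L(s', s)`. By `pairing_star` below, `⟨x ξ, η⟩ = ⟨ξ, x^* η⟩` for all
`ξ, η ∈ s'`, in particular for all `ξ, η ∈ ℓ₂`, so `x^*` is the hermitian adjoint of `x`. -/
instance : Star (SDual →L[ℂ] S) := ⟨fun x => mkCLM (adjointLin x) (adjointLin_bound x)⟩

theorem star_apply (x : SDual →L[ℂ] S) (η : SDual) (j : ℕ) :
    star x η j = pairing η (x (SDual.unit j)) := rfl

theorem pairing_star (x : SDual →L[ℂ] S) (ξ η : SDual) :
    pairing (x ξ) η = pairing ξ (star x η) := by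
  obtain ⟨q, hq⟩ := ξ.exists_wmem
  obtain ⟨r, hr⟩ := η.exists_wmem
  obtain ⟨C, hC0, hC⟩ := bound_of_clm x r q
  let φ : SDual →ₗ[ℂ] ℂ :=
    { toFun := fun ζ => conj (pairing η (x ζ)) - pairing ζ (star x η)
      map_add' := fun ζ ζ' => by
        rw [pairing_conj, pairing_conj, pairing_conj, pairing_add_left, map_add]
        have h : pairing (x ζ + x ζ' : S) η = pairing (x ζ) η + pairing (x ζ') η := by
          rw [pairing, pairing, pairing, ← Summable.tsum_add
            (pairing_summable ((x ζ).wmem r) hr) (pairing_summable ((x ζ').wmem r) hr)]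
          exact tsum_congr fun j => by rw [map_add, Pi.add_apply, add_mul]
        rw [h]; ring
      map_smul' := fun c ζ => by
        have h : pairing (c • x ζ : S) η = c * pairing (x ζ) η := by
          rw [pairing, pairing, ← tsum_mul_left]
          exact tsum_congr fun j => by rw [map_smul, Pi.smul_apply, smul_eq_mul, mul_assoc]
        rw [pairing_conj, pairing_conj, pairing_smul_left, map_smul, h]
        simp only [RingHom.id_apply, smul_eq_mul]
        ring }
  have h0 : φ ξ = 0 := by
    refine functional_eq_zero q φ (wnorm (-r) η * C + wnorm q (star x η)) ?_ ?_ ξ hq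
    · intro ζ hζ
      change ‖conj (pairing η (x ζ)) - pairing ζ (star x η)‖ ≤ _
      have h1 := norm_pairing_le hr ((x ζ).wmem _)
      have h2 := norm_pairing_le hζ ((star x η).wmem _)
      rw [neg_neg] at h1 h2
      have h3 := mul_le_mul_of_nonneg_left (hC ζ hζ) (wnorm_nonneg (-r) η)
      refine (norm_sub_le _ _).trans ?_
      rw [RCLike.norm_conj]
      nlinarith
    · intro j
      change conj (pairing η (x (SDual.unit j))) - pairing (Pi.single j 1) (star x η) = 0
      rw [← pairing_conj (star x η) (Pi.single j 1), pairing_single_right, star_apply, sub_self]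
  have h1 : conj (pairing η (x ξ)) - pairing ξ (star x η) = 0 := h0
  rwa [pairing_conj, sub_eq_zero] at h1

/-- `x` is determined by its pairings: `y = x^*` as soon as `⟨x ξ, η⟩ = ⟨ξ, y η⟩` for unit
vectors `ξ` and arbitrary `η`. -/
theorem eq_star_of_pairing {x y : SDual →L[ℂ] S}
    (h : ∀ (j : ℕ) (η : SDual), pairing (x (SDual.unit j)) η = pairing (SDual.unit j) (y η)) :
    y = star x := by
  ext1 η
  refine S.ext fun j => ?_
  have h1 := h j η
  change _ = pairing (Pi.single j 1) (y η) at h1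
  rw [← pairing_conj η, ← pairing_conj (y η), pairing_single_right] at h1
  rw [star_apply]
  exact ((starRingEnd ℂ).injective h1).symm

instance : StarRing (SDual →L[ℂ] S) where
  star_involutive x := by
    refine (eq_star_of_pairing fun j η => ?_).symm
    rw [← pairing_conj, ← pairing_star, pairing_conj]
  star_mul x y := by
    refine (eq_star_of_pairing fun j η => ?_).symm
    rw [mul_apply, mul_apply, pairing_star, ← pairing_star y]
    rfl
  star_add x y := by
    ext1 η
    refine S.ext fun j => ?_
    change pairing η (x (SDual.unit j) + y (SDual.unit j) : S)
      = pairing η (x (SDual.unit j)) + pairing η (y (SDual.unit j))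
    rw [pairing, pairing, pairing,
      ← (pairing_summable_ds η _).tsum_add (pairing_summable_ds η _)]
    exact tsum_congr fun i => by rw [map_add, Pi.add_apply, map_add, mul_add]

instance : StarModule ℂ (SDual →L[ℂ] S) where
  star_smul c x := by
    ext1 η
    refine S.ext fun j => ?_
    change pairing η (c • x (SDual.unit j) : S) = conj c * pairing η (x (SDual.unit j))
    rw [pairing, pairing, ← tsum_mul_left]
    exact tsum_congr fun i => by
      rw [map_smul, Pi.smul_apply, smul_eq_mul, map_mul]; ring

/-! ### Köthe matrices and Köthe algebras `λ^∞(A)` -/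

/-- A Köthe matrix `(a_{j,q})`. -/
structure KotheMatrix where
  /-- The entries `a_{j,q}`. -/
  entry : ℕ → ℕ → ℝ
  nonneg : ∀ j q, 0 ≤ entry j q
  exists_pos : ∀ j, ∃ q, 0 < entry j q
  mono : ∀ j q, entry j q ≤ entry j (q + 1)

/-- All entries are at least `1`; then `λ^∞(A)` is closed under pointwise multiplication. -/
class KotheMatrix.OneLE (A : KotheMatrix) : Prop where
  one_le : ∀ j q, 1 ≤ A.entry j q

/-- The sequences `ξ` with `sup_j |ξⱼ| a_{j,q} < ∞` for all `q`. -/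
def kotheSubmodule (A : KotheMatrix) : Submodule ℂ (ℕ → ℂ) where
  carrier := {ξ | ∀ q : ℕ, BddAbove (Set.range fun j => ‖ξ j‖ * A.entry j q)}
  zero_mem' := fun q => ⟨0, by rintro _ ⟨j, rfl⟩; simp⟩
  add_mem' := by
    intro ξ η hξ hη q
    obtain ⟨C, hC⟩ := hξ q
    obtain ⟨D, hD⟩ := hη q
    refine ⟨C + D, ?_⟩
    rintro _ ⟨j, rfl⟩
    have h1 := hC ⟨j, rfl⟩
    have h2 := hD ⟨j, rfl⟩
    have h3 := mul_le_mul_of_nonneg_right (norm_add_le (ξ j) (η j)) (A.nonneg j q)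
    simp only [Pi.add_apply] at *
    linarith
  smul_mem' := by
    intro c ξ hξ q
    obtain ⟨C, hC⟩ := hξ q
    refine ⟨‖c‖ * C, ?_⟩
    rintro _ ⟨j, rfl⟩
    have h1 := mul_le_mul_of_nonneg_left (hC ⟨j, rfl⟩) (norm_nonneg c)
    simp only [Pi.smul_apply, smul_eq_mul, norm_mul] at *
    linarith

/-- The Köthe space `λ^∞(A)`; a type of its own, so that it does not carry the topology of
`ℂ^ℕ`. -/
def KotheSpace (A : KotheMatrix) : Type := kotheSubmodule A

namespace KotheSpace

variable {A : KotheMatrix}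

instance : AddCommGroup (KotheSpace A) := inferInstanceAs (AddCommGroup (kotheSubmodule A))
instance : Module ℂ (KotheSpace A) := inferInstanceAs (Module ℂ (kotheSubmodule A))

/-- The sequence of coordinates of an element of `λ^∞(A)`. -/
def toSeq : KotheSpace A →ₗ[ℂ] (ℕ → ℂ) := (kotheSubmodule A).subtype

instance : CoeFun (KotheSpace A) fun _ => ℕ → ℂ := ⟨fun ξ => toSeq ξ⟩

/-- The element of `λ^∞(A)` with given coordinates. -/
def mk (ξ : ℕ → ℂ) (h : ∀ q : ℕ, BddAbove (Set.range fun j => ‖ξ j‖ * A.entry j q)) :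
    KotheSpace A := (⟨ξ, h⟩ : kotheSubmodule A)

theorem toSeq_mk (ξ : ℕ → ℂ)
    (h : ∀ q : ℕ, BddAbove (Set.range fun j => ‖ξ j‖ * A.entry j q)) :
    toSeq (mk ξ h) = ξ := rfl

theorem ext {ξ η : KotheSpace A} (h : ∀ j, ξ j = η j) : ξ = η := Subtype.ext (funext h)

theorem bddAbove (ξ : KotheSpace A) (q : ℕ) :
    BddAbove (Set.range fun j => ‖ξ j‖ * A.entry j q) :=
  Subtype.prop (p := (· ∈ kotheSubmodule A)) ξ q

theorem le_iSup (ξ : KotheSpace A) (q j : ℕ) :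
    ‖ξ j‖ * A.entry j q ≤ ⨆ i, ‖ξ i‖ * A.entry i q := le_ciSup (ξ.bddAbove q) j

variable (A) in
/-- The seminorms `|ξ|_{∞,q} = sup_j |ξⱼ| a_{j,q}` on `λ^∞(A)`. -/
def seminorms : SeminormFamily ℂ (KotheSpace A) ℕ := fun q =>
  Seminorm.of (fun ξ => ⨆ j, ‖ξ j‖ * A.entry j q)
    (fun ξ η => ciSup_le fun j => by
      have h1 := le_iSup ξ q j
      have h2 := le_iSup η q j
      have h3 := mul_le_mul_of_nonneg_right (norm_add_le (ξ j) (η j)) (A.nonneg j q)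
      rw [map_add, Pi.add_apply]
      linarith)
    (fun c ξ => by
      rw [Real.mul_iSup_of_nonneg (norm_nonneg c)]
      refine iSup_congr fun j => ?_
      rw [map_smul, Pi.smul_apply, smul_eq_mul, norm_mul, mul_assoc])

theorem seminorms_apply (q : ℕ) (ξ : KotheSpace A) :
    seminorms A q ξ = ⨆ j, ‖ξ j‖ * A.entry j q := rfl

/-- The topology of `λ^∞(A)` is given by the seminorms `|·|_{∞,q}`. -/
instance : TopologicalSpace (KotheSpace A) := (seminorms A).moduleFilterBasis.topology

theorem withSeminorms : WithSeminorms (seminorms A) := ⟨rfl⟩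

instance : IsTopologicalAddGroup (KotheSpace A) := withSeminorms.topologicalAddGroup
instance : ContinuousSMul ℂ (KotheSpace A) := withSeminorms.continuousSMul

/-- Pointwise multiplication. -/
instance [A.OneLE] : Mul (KotheSpace A) :=
  ⟨fun ξ η => mk (⇑ξ * ⇑η) fun q => by
    obtain ⟨C, hC⟩ := ξ.bddAbove q
    obtain ⟨D, hD⟩ := η.bddAbove q
    refine ⟨C * D, ?_⟩
    rintro _ ⟨j, rfl⟩
    have ha := KotheMatrix.OneLE.one_le (A := A) j q
    have h1 : ‖ξ j‖ * A.entry j q ≤ C := hC ⟨j, rfl⟩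
    have h2 : ‖η j‖ * A.entry j q ≤ D := hD ⟨j, rfl⟩
    have h3 : ‖ξ j‖ ≤ C := (le_mul_of_one_le_right (norm_nonneg _) ha).trans h1
    change ‖ξ j * η j‖ * A.entry j q ≤ C * D
    rw [norm_mul, mul_assoc]
    exact mul_le_mul h3 h2 (mul_nonneg (norm_nonneg _) (A.nonneg j q))
      ((norm_nonneg _).trans h3)⟩

theorem mul_apply [A.OneLE] (ξ η : KotheSpace A) (j : ℕ) : (ξ * η) j = ξ j * η j := rfl

instance [A.OneLE] : NonUnitalCommRing (KotheSpace A) :=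
  { (inferInstance : AddCommGroup (KotheSpace A)) with
    mul := (· * ·)
    left_distrib := fun ξ η ζ => ext fun j => mul_add (ξ j) (η j) (ζ j)
    right_distrib := fun ξ η ζ => ext fun j => add_mul (ξ j) (η j) (ζ j)
    zero_mul := fun ξ => ext fun j => zero_mul (ξ j)
    mul_zero := fun ξ => ext fun j => mul_zero (ξ j)
    mul_assoc := fun ξ η ζ => ext fun j => mul_assoc (ξ j) (η j) (ζ j)
    mul_comm := fun ξ η => ext fun j => mul_comm (ξ j) (η j) }

instance [A.OneLE] : IsScalarTower ℂ (KotheSpace A) (KotheSpace A) :=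
  ⟨fun c ξ η => ext fun j => mul_assoc c (ξ j) (η j)⟩

instance [A.OneLE] : SMulCommClass ℂ (KotheSpace A) (KotheSpace A) :=
  ⟨fun c ξ η => ext fun j => (mul_left_comm (ξ j) c (η j)).symm⟩

/-- Pointwise conjugation. -/
instance : Star (KotheSpace A) :=
  ⟨fun ξ => mk (fun j => conj (ξ j)) fun q => by simpa using ξ.bddAbove q⟩

theorem star_apply (ξ : KotheSpace A) (j : ℕ) : star ξ j = conj (ξ j) := rfl

instance [A.OneLE] : StarRing (KotheSpace A) where
  star_involutive ξ := ext fun j => Complex.conj_conj (ξ j)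
  star_mul ξ η := ext fun j => by
    rw [star_apply, mul_apply, mul_apply, star_apply, star_apply, map_mul, mul_comm]
  star_add ξ η := ext fun j => map_add (starRingEnd ℂ) (ξ j) (η j)

instance [A.OneLE] : StarModule ℂ (KotheSpace A) where
  star_smul c ξ := ext fun j => map_mul (starRingEnd ℂ) c (ξ j)

variable (A) in
/-- The unit vector `eⱼ`, as an element of `λ^∞(A)`. -/
def unit (j : ℕ) : KotheSpace A :=
  mk (Pi.single j 1) fun q => ⟨A.entry j q, by
    rintro _ ⟨i, rfl⟩
    by_cases h : i = j
    · subst h; simp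
    · simp [h, A.nonneg j q]⟩

end KotheSpace

/-! ### Orthonormal sequences in `s` and the algebras `λ^∞(|f_k|_q)` -/

/-- `(f_k)` is an orthonormal sequence of `ℓ₂` whose elements belong to `s`. -/
def OrthonormalSeq (f : ℕ → S) : Prop :=
  ∀ i j, pairing (f i) (f j) = if i = j then 1 else 0

theorem OrthonormalSeq.wnorm_zero {f : ℕ → S} (hf : OrthonormalSeq f) (k : ℕ) :
    wnorm 0 (f k) = 1 := by
  have h := hf k k
  rw [if_pos rfl, pairing] at h
  have h2 : ∑' j : ℕ, f k j * conj (f k j)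
      = ((∑' j : ℕ, ‖f k j‖ ^ 2 * ((j : ℝ) + 1) ^ (2 * (0 : ℤ)) : ℝ) : ℂ) := by
    rw [Complex.ofReal_tsum]
    exact tsum_congr fun j => by simp [Complex.mul_conj, Complex.normSq_eq_norm_sq]
  rw [h2] at h
  rw [wnorm, Complex.ofReal_eq_one.1 h, Real.sqrt_one]

theorem OrthonormalSeq.one_le {f : ℕ → S} (hf : OrthonormalSeq f) (k q : ℕ) :
    1 ≤ sNorm q (f k) := by
  rw [← hf.wnorm_zero k]
  exact wnorm_mono (by positivity) ((f k).wmem q)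

/-- The Köthe matrix `(|f_k|_q)_{k,q}` of an orthonormal sequence `(f_k)` in `s`. -/
def normMatrix (f : ℕ → S) (hf : OrthonormalSeq f) : KotheMatrix where
  entry k q := sNorm q (f k)
  nonneg _ _ := apply_nonneg _ _
  exists_pos k := ⟨0, one_pos.trans_le (hf.one_le k 0)⟩
  mono k q := wnorm_mono (by simp) ((f k).wmem _)

instance (f : ℕ → S) (hf : OrthonormalSeq f) : (normMatrix f hf).OneLE := ⟨hf.one_le⟩

/-! ### Closed `*`-subalgebras, canonical Schauder bases, isomorphisms -/

/-- The closed `*`-subalgebra generated by `Z`: the smallest closed `*`-subalgebra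
containing `Z`. -/
def closedAdjoin {B : Type*} [NonUnitalRing B] [Module ℂ B] [IsScalarTower ℂ B B]
    [SMulCommClass ℂ B B] [StarRing B] [StarModule ℂ B] [TopologicalSpace B] (Z : Set B) :
    NonUnitalStarSubalgebra ℂ B :=
  sInf {F | IsClosed (F : Set B) ∧ Z ⊆ F}

section Algebra

variable {B C : Type*} [NonUnitalRing B] [Module ℂ B] [StarRing B]
  [NonUnitalRing C] [Module ℂ C] [StarRing C]

/-- A nonzero projection of the `*`-algebra `E` that is minimal among the nonzero projections
of `E` (for the order `Q ≤ P ↔ Q P = Q`). -/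
structure IsMinimalProjection (E : NonUnitalStarSubalgebra ℂ B) (P : B) : Prop where
  mem : P ∈ E
  isStarProjection : IsStarProjection P
  ne_zero : P ≠ 0
  eq_of_le : ∀ Q ∈ E, IsStarProjection Q → Q ≠ 0 → Q * P = Q → Q = P

/-- The sequence `(P_k)` enumerates, without repetition, all nonzero minimal projections
of `E`; for a closed commutative `*`-subalgebra `E` of `L(s', s)` this is what is called its
canonical Schauder basis. -/
structure IsCanonicalBasis (E : NonUnitalStarSubalgebra ℂ B) (P : ℕ → B) : Prop where
  injective : Function.Injective P
  range_eq : Set.range P = {Q | IsMinimalProjection E Q}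

theorem IsCanonicalBasis.mem {E : NonUnitalStarSubalgebra ℂ B} {P : ℕ → B}
    (h : IsCanonicalBasis E P) (k : ℕ) : P k ∈ E := by
  have : P k ∈ {Q | IsMinimalProjection E Q} := h.range_eq ▸ Set.mem_range_self k
  exact this.mem

/-- Isomorphism as Fréchet `*`-algebras: a `*`-algebra isomorphism that is a homeomorphism. -/
def FrechetIso [TopologicalSpace B] [TopologicalSpace C] (E : NonUnitalStarSubalgebra ℂ B)
    (F : NonUnitalStarSubalgebra ℂ C) : Prop :=
  ∃ Φ : E ≃⋆ₐ[ℂ] F, Continuous Φ ∧ Continuous Φ.symm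

end Algebra

end SmoothOp
end

open scoped ComplexConjugate

noncomputable section

namespace SmoothOp

/-! ### The Hilbert space `ℓ₂` and the operators induced on it -/

/-! An operator `x : s' → s` restricts to `hat x` on ℓ₂, and this determines `x`. It is compact,
because the values have square-summable coordinates even after multiplication by the weight j+1
(`isCompactOperator_hat`). A commutative *-algebra of compact operators is simultaneously
diagonalizable, and an eigenvector for a nonzero eigenvalue μ lies in s, since v = μ⁻¹xv. Hence
every commutative *-subalgebra E consists of operators ∑ ξⱼ⟨·,fⱼ⟩fⱼ for one orthonormal sequence
(fⱼ) in s (`exists_subset_range_diag`).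

It remains to see that `diag`, ξ ↦ ∑ ξⱼ⟨·,fⱼ⟩fⱼ, embeds λ^∞(|f_k|_q) as a closed *-subalgebra of
L(s',s) (`isClosedEmbedding_diag`). Its continuity rests on two facts about orthonormal sequences in
s: Cauchy–Schwarz gives |fⱼ|_q⁴ ≤ |fⱼ|_{4q}, so products of norms are controlled by one entry of the
matrix (`OrthonormalSeq.pow_four_le`), and ∑ |fⱼ|₁⁻² < ∞ (`OrthonormalSeq.summable_inv_sq`).
Conversely, evaluation at the fⱼ, a bounded set of s', recovers the seminorms of ξ. Statements (1)
and (3) follow by taking the preimage of E and the image of F.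

In (2) the sequence (fⱼ) is prescribed and need not be the one that diagonalization produces. The
latter serves only to prove two intrinsic facts: every nonzero x in E satisfies xP ≠ 0 for some
minimal projection P, and xP is always a multiple of P. Both are read off in λ^∞, where projections
are indicators of finite sets and powers of |ξ|²/max|ξ|² converge to one (`exists_ind_mem`). They
yield the expansion of x along the given basis (`exists_diag_eq`) and identify the preimage of E
with the closed algebra generated by the indicators (`mem_closedAdjoin_iff`). -/

/-- The Hilbert space `ℓ₂`. -/
abbrev L2 : Type := lp (fun _ : ℕ => ℂ) 2

theorem wseq_zero (ξ : ℕ → ℂ) : wseq 0 ξ = ξ := by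
  funext j; simp [wseq]

theorem L2.wmem (g : L2) : WMem 0 g := by
  rw [wmem_iff, wseq_zero]; exact g.2

theorem L2.wnorm_zero (g : L2) : wnorm 0 g = ‖g‖ := by
  rw [wnorm_eq g.wmem]
  congr 1
  exact Subtype.ext (wseq_zero g)

/-- The inclusion of `s` into `ℓ₂`. -/
def S.toL2 : S →ₗ[ℂ] L2 where
  toFun ξ := ⟨S.toSeq ξ, by
    have := (wmem_iff 0 ξ).1 (ξ.wmem 0); rwa [wseq_zero] at this⟩
  map_add' _ _ := rfl
  map_smul' _ _ := rfl

/-- The inclusion of `ℓ₂` into `s'`. -/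
def L2.toDual : L2 →ₗ[ℂ] SDual where
  toFun g := SDual.mk g ⟨0, g.wmem⟩
  map_add' _ _ := rfl
  map_smul' _ _ := rfl

theorem L2.toSeq_toDual (g : L2) : SDual.toSeq (L2.toDual g) = g := rfl

theorem toDual_toL2 (ξ : S) : L2.toDual (S.toL2 ξ) = incl ξ := rfl

theorem S.toL2_injective : Function.Injective S.toL2 := fun _ _ h =>
  S.ext fun j => congrFun (congrArg Subtype.val h) j

theorem S.norm_toL2 (ξ : S) : ‖S.toL2 ξ‖ = wnorm 0 ξ := (L2.wnorm_zero _).symm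

theorem pairing_eq_inner (g h : L2) : pairing g h = inner ℂ h g := by
  rw [lp.inner_eq_tsum]
  rfl

/-- The operator on `ℓ₂` induced by an operator `s' → s`. -/
def hat (x : SDual →L[ℂ] S) : L2 →L[ℂ] L2 :=
  (S.toL2 ∘ₗ x.toLinearMap ∘ₗ L2.toDual).mkContinuousOfExistsBound <| by
    obtain ⟨C, -, hC⟩ := bound_of_clm x 0 0
    refine ⟨C, fun g => ?_⟩
    have := hC (L2.toDual g) (by simpa using! g.wmem)
    simp only [Nat.cast_zero, neg_zero, L2.toSeq_toDual, L2.wnorm_zero] at this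
    exact (S.norm_toL2 _).trans_le this

theorem hat_apply (x : SDual →L[ℂ] S) (g : L2) : hat x g = S.toL2 (x (L2.toDual g)) := rfl

theorem hat_mul (x y : SDual →L[ℂ] S) (g : L2) : hat (x * y) g = hat x (hat y g) := rfl

theorem inner_hat (x : SDual →L[ℂ] S) (g h : L2) :
    inner ℂ (hat x g) h = inner ℂ g (hat (star x) h) := by
  rw [← inner_conj_symm, ← inner_conj_symm g, ← pairing_eq_inner, ← pairing_eq_inner]
  congr 1
  exact pairing_star x (L2.toDual g) (L2.toDual h)

/-- The adjoint is written in terms of the values at the unit vectors alone, and the involution is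
injective. -/
theorem clm_ext_unit {x y : SDual →L[ℂ] S} (h : ∀ j, x (SDual.unit j) = y (SDual.unit j)) :
    x = y := by
  refine star_injective (ContinuousLinearMap.ext fun η => S.ext fun j => ?_)
  rw [star_apply, star_apply, h]

theorem eq_zero_of_hat_eq_zero {x : SDual →L[ℂ] S} (h : hat x = 0) : x = 0 := by
  refine clm_ext_unit fun j => S.toL2_injective ?_
  have := DFunLike.congr_fun h (S.toL2 (S.unit j))
  rw [hat_apply, toDual_toL2] at this
  rw [zero_apply, map_zero]
  exact this

/-- Two operators `s' → s` coincide if they agree on a family in `s` and on its orthogonal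
complement in `ℓ₂`. -/
theorem clm_ext_family {ι : Type*} (f : ι → S) {x y : SDual →L[ℂ] S}
    (h : ∀ i, x (incl (f i)) = y (incl (f i)))
    (h' : ∀ g : L2, (∀ i, pairing g (f i) = 0) → x (L2.toDual g) = y (L2.toDual g)) : x = y := by
  rw [← sub_eq_zero]
  refine eq_zero_of_hat_eq_zero ?_
  have hker : (hat (x - y)).ker = ⊤ := by
    have hcl : IsClosed ((hat (x - y)).ker : Set L2) := (hat (x - y)).isClosed_ker
    have : CompleteSpace (hat (x - y)).ker := hcl.completeSpace_coe
    -- The kernel contains every `f i`, so a vector orthogonal to the kernel satisfies the premise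
    -- of `h'` and lies in the kernel itself.
    rw [← Submodule.orthogonal_eq_bot_iff, eq_bot_iff]
    intro g hg
    have h1 : g ∈ (hat (x - y)).ker := by
      change S.toL2 ((x - y) (L2.toDual g)) = 0
      rw [sub_apply, h' g, sub_self, map_zero]
      intro i
      refine (pairing_eq_inner g (S.toL2 (f i))).trans ?_
      refine hg _ ?_
      change S.toL2 ((x - y) (incl (f i))) = 0
      rw [sub_apply, h i, sub_self, map_zero]
    exact inner_self_eq_zero.1 (hg g h1)
  ext1 g
  have : g ∈ (hat (x - y)).ker := hker ▸ Submodule.mem_top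
  exact this

/-! ### Compactness of the induced operators. -/

/-- The truncation of a sequence to its first `n` coordinates. -/
def truncate (n : ℕ) : L2 →L[ℂ] L2 :=
  ∑ i ∈ Finset.range n, (lp.singleContinuousLinearMap ℂ (fun _ : ℕ => ℂ) 2 i) ∘L
    (lp.evalCLM ℂ (fun _ : ℕ => ℂ) 2 i)

theorem truncate_apply (n : ℕ) (g : L2) (j : ℕ) : truncate n g j = if j < n then g j else 0 := by
  have h : truncate n g = ∑ i ∈ Finset.range n, lp.single 2 i (g i) := by
    simp [truncate, lp.evalCLM]
  rw [h, lp.coeFn_sum, Finset.sum_apply]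
  simp [Pi.single_apply]

theorem isCompactOperator_truncate (n : ℕ) : IsCompactOperator (truncate n) := by
  have : truncate n ∈ compactOperator (RingHom.id ℂ) L2 L2 := by
    refine Submodule.sum_mem _ fun i _ => ?_
    exact (isCompactOperator_of_locallyCompactSpace_dom
      (lp.evalCLM ℂ (fun _ : ℕ => ℂ) 2 i)).clm_comp
      (lp.singleContinuousLinearMap ℂ (fun _ : ℕ => ℂ) 2 i)
  exact this

/-- The remaining coordinates have index j ≥ n, where the weight j + 1 is at least n + 1. -/
theorem norm_sub_truncate_le (n : ℕ) (ξ : S) :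
    ‖S.toL2 ξ - truncate n (S.toL2 ξ)‖ ≤ wnorm 1 ξ / (n + 1) := by
  have hn : (0 : ℝ) < (n : ℝ) + 1 := by positivity
  rw [← L2.wnorm_zero, le_div_iff₀ hn, ← Real.sqrt_sq hn.le, wnorm, wnorm,
    ← Real.sqrt_mul (by positivity)]
  refine Real.sqrt_le_sqrt ?_
  rw [← tsum_mul_right]
  refine Summable.tsum_le_tsum (fun j => ?_) ((L2.wmem _).mul_right _) (ξ.wmem 1)
  have h : (S.toL2 ξ - truncate n (S.toL2 ξ) : L2) j = if j < n then 0 else ξ j := by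
    rw [lp.coeFn_sub, Pi.sub_apply, truncate_apply]
    split_ifs
    · exact sub_self _
    · exact sub_zero _
  rw [h]
  split_ifs with hj
  · have := zpow_pos (weight_pos j) (2 * 1)
    rw [norm_zero, zero_pow two_ne_zero, zero_mul, zero_mul]
    positivity
  · simp only [mul_zero, zpow_zero, mul_one]
    refine mul_le_mul_of_nonneg_left ?_ (by positivity)
    have : (n : ℝ) ≤ j := by exact_mod_cast not_lt.1 hj
    norm_cast
    gcongr
    exact not_lt.1 hj

/-- Boundedness of x from ℓ₂ into the norm |·|₁ makes the finite-rank truncations converge in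
operator norm, with error at most C/(n+1). -/
theorem isCompactOperator_hat (x : SDual →L[ℂ] S) : IsCompactOperator (hat x) := by
  obtain ⟨C, hC0, hC⟩ := bound_of_clm x 1 0
  refine isCompactOperator_of_tendsto (l := Filter.atTop)
    (F := fun n : ℕ => truncate n ∘L hat x) ?_
    (Filter.Eventually.of_forall fun n => (isCompactOperator_truncate n).comp_clm (hat x))
  rw [tendsto_iff_norm_sub_tendsto_zero]
  refine squeeze_zero (fun _ => norm_nonneg _) (fun n => ?_)
    (tendsto_const_div_atTop_nhds_zero_nat C |>.comp (Filter.tendsto_add_atTop_nat 1))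
  refine ContinuousLinearMap.opNorm_le_bound _ (div_nonneg hC0 (Nat.cast_nonneg _)) fun g => ?_
  have h1 := norm_sub_truncate_le n (x (L2.toDual g))
  have h2 := hC (L2.toDual g) (by simpa using! g.wmem)
  simp only [Nat.cast_zero, Nat.cast_one, neg_zero, L2.toSeq_toDual, L2.wnorm_zero] at h2
  rw [norm_sub_rev] at h1
  refine h1.trans ?_
  simp only [Function.comp_apply, Nat.cast_add, Nat.cast_one]
  rw [div_mul_eq_mul_div]
  gcongr

/-! ### Series in `s` -/

theorem S.eq_zero_of_wnorm_eq_zero {ξ : S} (h : wnorm 0 ξ = 0) : ξ = 0 := by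
  rw [← S.norm_toL2, norm_eq_zero] at h
  exact S.toL2_injective (h.trans (map_zero _).symm)

instance : T2Space S := by
  have : T1Space S := S.withSeminorms.T1_of_separating fun ξ hξ =>
    ⟨0, fun h => hξ (S.eq_zero_of_wnorm_eq_zero h)⟩
  infer_instance

/-- The linear functional `⟨·, η⟩` on `s`, for `η ∈ s'`. -/
def S.pairingLin (η : SDual) : S →ₗ[ℂ] ℂ where
  toFun ξ := pairing ξ η
  map_add' ξ ξ' := by
    obtain ⟨r, hr⟩ := η.exists_wmem
    rw [pairing, pairing, pairing, ← Summable.tsum_add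
      (pairing_summable (ξ.wmem r) hr) (pairing_summable (ξ'.wmem r) hr)]
    exact tsum_congr fun j => by rw [map_add, Pi.add_apply, add_mul]
  map_smul' c ξ := by
    rw [pairing, pairing, RingHom.id_apply, smul_eq_mul, ← tsum_mul_left]
    exact tsum_congr fun j => by rw [map_smul, Pi.smul_apply, smul_eq_mul, mul_assoc]

/-- The continuous functional `⟨·, η⟩` on `s`, for `η ∈ s'`. -/
def S.pairingCLM (η : SDual) : S →L[ℂ] ℂ where
  toLinearMap := S.pairingLin η
  cont := by
    obtain ⟨r, hr⟩ := η.exists_wmem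
    refine WithSeminorms.continuous_of_isBounded S.withSeminorms (norm_withSeminorms ℂ ℂ) _
      fun _ => ⟨{r}, (wnorm (-r) η).toNNReal, fun ξ => ?_⟩
    rw [Finset.sup_singleton, smul_apply, NNReal.smul_def, smul_eq_mul,
      Real.coe_toNNReal _ (wnorm_nonneg _ _)]
    exact (norm_pairing_le (ξ.wmem r) hr).trans_eq (mul_comm _ _)

theorem S.pairingCLM_apply (η : SDual) (ξ : S) : S.pairingCLM η ξ = pairing ξ η := rfl

/-- The sequence `ξ ∈ s` multiplied by the weight `(j+1)^p`, as an element of `ℓ₂`. -/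
def S.weighted (p : ℤ) : S →ₗ[ℂ] L2 where
  toFun ξ := ⟨wseq p ξ, (wmem_iff p ξ).1 (ξ.wmem p)⟩
  map_add' ξ η := Subtype.ext (wseq_add p ξ η)
  map_smul' c ξ := Subtype.ext (wseq_smul p c ξ)

theorem S.norm_weighted (p : ℤ) (ξ : S) : ‖S.weighted p ξ‖ = wnorm p ξ :=
  (wnorm_eq (ξ.wmem p)).symm

/-- A series in `s` that converges absolutely for every norm `|·|_q` converges. -/
theorem S.summable_of_summable_wnorm {ι : Type*} {u : ι → S}
    (h : ∀ q : ℕ, Summable fun j => wnorm q (u j)) : Summable u := by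
  have hs : ∀ q : ℕ, Summable fun j => S.weighted q (u j) := fun q =>
    Summable.of_norm (by simpa only [S.norm_weighted] using h q)
  let G : ℕ → L2 := fun q => ∑' j, S.weighted q (u j)
  have hG : ∀ q : ℕ, HasSum (fun j => S.weighted q (u j)) (G q) := fun q => (hs q).hasSum
  have hGi : ∀ (q : ℕ) i, HasSum (fun j => u j i * ((((i : ℝ) + 1) ^ (q : ℤ) : ℝ) : ℂ)) (G q i) :=
    fun q i => (hG q).mapL (lp.evalCLM ℂ (fun _ : ℕ => ℂ) 2 i)
  have h0 : ∀ i, HasSum (fun j => u j i) (G 0 i) := fun i => by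
    simpa using! hGi 0 i
  -- The sums in the different weighted spaces agree coordinatewise, so the single sequence `G 0`
  -- has all its norms finite.
  have hw : ∀ q : ℕ, wseq q (G 0) = G q := fun q => funext fun i =>
    ((h0 i).mul_right _).unique (hGi q i)
  let g : S := S.mk (G 0) fun q => by rw [wmem_iff, hw]; exact (G q).2
  have hg : ∀ q : ℕ, S.weighted q g = G q := fun q => Subtype.ext (hw q)
  refine ⟨g, ?_⟩
  refine (S.withSeminorms.tendsto_nhds _ g).2 fun q ε hε => ?_
  have h1 := (tendsto_iff_norm_sub_tendsto_zero.1 (hG q)).eventually (gt_mem_nhds hε)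
  filter_upwards [h1] with F hF
  rw [sNorm_apply, ← S.norm_weighted, map_sub, map_sum, hg]
  exact hF

theorem S.wnorm_tsum_le {ι : Type*} {u : ι → S}
    (h : ∀ q : ℕ, Summable fun j => wnorm q (u j)) (q : ℕ) :
    wnorm q (S.toSeq (∑' j, u j)) ≤ ∑' j, wnorm q (u j) := by
  have h1 := ((S.withSeminorms.continuous_seminorm q).tendsto _).comp
    (S.summable_of_summable_wnorm h).hasSum
  refine le_of_tendsto h1 (Filter.Eventually.of_forall fun F => ?_)
  refine (Finset.le_sum_of_subadditive (sNorm q) (map_zero _).le (map_add_le_add _) F u).trans ?_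
  exact (h q).sum_le_tsum F fun _ _ => wnorm_nonneg _ _

/-! ### Norm estimates for orthonormal sequences in `s` -/

theorem pairing_wseq_self (ξ : S) (q : ℕ) :
    pairing ξ (wseq (2 * q) ξ) = ((wnorm q ξ ^ 2 : ℝ) : ℂ) := by
  rw [wnorm, Real.sq_sqrt (tsum_nonneg fun j => ?_), Complex.ofReal_tsum]
  · refine tsum_congr fun j => ?_
    rw [wseq, map_mul, Complex.conj_ofReal, ← mul_assoc, Complex.mul_conj,
      Complex.normSq_eq_norm_sq, Complex.ofReal_mul]
  · have := zpow_pos (weight_pos j) (2 * (q : ℤ))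
    positivity

theorem wmem_zero_wseq (p : ℤ) (ξ : S) : WMem 0 (wseq p ξ) := by
  rw [wmem_iff, wseq_zero, ← wmem_iff]
  exact ξ.wmem p

theorem wnorm_zero_wseq (p : ℤ) (ξ : S) : wnorm 0 (wseq p ξ) = wnorm p ξ := by
  rw [wnorm, wnorm]
  congr 1
  refine tsum_congr fun j => ?_
  rw [norm_wseq_sq, mul_zero, zpow_zero, mul_one]

/-- Cauchy–Schwarz in ℓ₂ for ξ and its multiple by the weight (j+1)^{2q}. -/
theorem wnorm_sq_le (ξ : S) (q : ℕ) : wnorm q ξ ^ 2 ≤ wnorm 0 ξ * wnorm (2 * q) ξ := by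
  have h := norm_pairing_le (ξ.wmem 0) (by simpa using wmem_zero_wseq (2 * q) ξ)
  rw [pairing_wseq_self, neg_zero, wnorm_zero_wseq, Complex.norm_real,
    Real.norm_of_nonneg (by positivity)] at h
  exact h

theorem OrthonormalSeq.orthonormal {f : ℕ → S} (hf : OrthonormalSeq f) :
    Orthonormal ℂ fun j => S.toL2 (f j) := by
  rw [orthonormal_iff_ite]
  intro i j
  rw [← pairing_eq_inner]
  refine (hf j i).trans ?_
  simp only [eq_comm]

theorem OrthonormalSeq.one_le_wnorm {f : ℕ → S} (hf : OrthonormalSeq f) (k q : ℕ) :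
    1 ≤ wnorm q (f k) := hf.one_le k q

/-- The interpolation inequality applied twice, with |fⱼ|₀ = 1. A product of four norms of fⱼ is
thereby absorbed into a single one. -/
theorem OrthonormalSeq.pow_four_le {f : ℕ → S} (hf : OrthonormalSeq f) (j q : ℕ) :
    wnorm q (f j) ^ 4 ≤ wnorm (4 * q : ℕ) (f j) := by
  have h1 := wnorm_sq_le (f j) q
  have h2 := wnorm_sq_le (f j) (2 * q)
  rw [hf.wnorm_zero, one_mul] at h1 h2
  have h3 : wnorm (2 * (2 * q : ℕ)) (f j) = wnorm (4 * q : ℕ) (f j) := by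
    congr 1; push_cast; ring
  rw [h3] at h2
  refine le_trans ?_ h2
  push_cast
  calc wnorm q (f j) ^ 4 = (wnorm q (f j) ^ 2) ^ 2 := by ring
    _ ≤ _ := pow_le_pow_left₀ (by positivity) h1 2

/-- Bessel's inequality for the i-th unit vector. -/
theorem OrthonormalSeq.sum_norm_sq_le {f : ℕ → S} (hf : OrthonormalSeq f) (F : Finset ℕ) (i : ℕ) :
    ∑ j ∈ F, ‖f j i‖ ^ 2 ≤ 1 := by
  have h := hf.orthonormal.sum_inner_products_le (x := S.toL2 (S.unit i)) (s := F)
  have h1 : ‖S.toL2 (S.unit i)‖ = 1 := by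
    rw [S.norm_toL2]
    exact (wnorm_single 0 i).trans (zpow_zero _)
  rw [h1, one_pow] at h
  refine le_trans (le_of_eq (Finset.sum_congr rfl fun j _ => ?_)) h
  rw [norm_inner_symm, ← pairing_eq_inner]
  congr 2
  exact (pairing_single_right _ _).symm

/-- A Hilbert–Schmidt argument: summing over j first, Bessel in each coordinate gives ∑ⱼ |fⱼ|₋₁² ≤
∑ᵢ (i+1)⁻². The duality bound 1 = ⟨fⱼ,fⱼ⟩ ≤ |fⱼ|₁|fⱼ|₋₁ then converts this into the claim. -/
theorem OrthonormalSeq.summable_inv_sq {f : ℕ → S} (hf : OrthonormalSeq f) :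
    Summable fun j => (wnorm 1 (f j) ^ 2)⁻¹ := by
  have hS : Summable fun i : ℕ => ((i : ℝ) + 1) ^ (2 * (-1 : ℤ)) := by
    refine summable_inv_weight.congr fun i => ?_
    rw [mul_neg, mul_one, zpow_neg, one_div]
    norm_cast
  have h1 : Summable fun j => wnorm (-1) (f j) ^ 2 := by
    refine summable_of_sum_le (c := ∑' i : ℕ, ((i : ℝ) + 1) ^ (2 * (-1 : ℤ)))
      (fun j => by positivity) fun F => ?_
    have h2 : ∀ j, wnorm (-1) (f j) ^ 2
        = ∑' i : ℕ, ‖f j i‖ ^ 2 * ((i : ℝ) + 1) ^ (2 * (-1 : ℤ)) := fun j => by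
      refine Real.sq_sqrt (tsum_nonneg fun i => ?_)
      have := zpow_pos (weight_pos i) (2 * (-1 : ℤ))
      positivity
    simp only [h2]
    rw [← Summable.tsum_finsetSum fun j _ => (f j).wmem (-1)]
    refine Summable.tsum_le_tsum (fun i => ?_) (summable_sum fun j _ => (f j).wmem (-1)) hS
    rw [← Finset.sum_mul]
    exact mul_le_of_le_one_left (zpow_pos (weight_pos i) _).le (hf.sum_norm_sq_le F i)
  refine Summable.of_nonneg_of_le (fun j => by positivity) (fun j => ?_) h1
  have h3 := norm_pairing_le ((f j).wmem 1) ((f j).wmem (-1))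
  rw [hf j j, if_pos rfl, norm_one] at h3
  have h4 := hf.one_le_wnorm j 1
  rw [Nat.cast_one] at h4
  rw [← inv_pow]
  refine pow_le_pow_left₀ (by positivity) ?_ 2
  rw [inv_le_iff_one_le_mul₀ (by positivity)]
  linarith

/-! ### Bounded subsets of `s'` -/

/-- For a sequence `(gₙ)` in `s` with bounded norms `|gₙ|_q` for each `q`, the seminorm
`η ↦ supₙ |⟨η, gₙ⟩|` on `s'`. -/
def supPairing (g : ℕ → S) (D : ℕ → ℝ) (hD : ∀ q n : ℕ, wnorm q (g n) ≤ D q) :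
    Seminorm ℂ SDual :=
  have hb : ∀ η : SDual, BddAbove (Set.range fun n => ‖pairing η (g n)‖) := fun η => by
    obtain ⟨q, hq⟩ := η.exists_wmem
    refine ⟨wnorm (-q) η * D q, ?_⟩
    rintro _ ⟨n, rfl⟩
    have h := norm_pairing_le hq ((g n).wmem _)
    rw [neg_neg] at h
    exact h.trans (mul_le_mul_of_nonneg_left (hD q n) (wnorm_nonneg _ _))
  Seminorm.of (fun η => ⨆ n, ‖pairing η (g n)‖)
    (fun η ζ => ciSup_le fun n => by
      rw [pairing_add_left]
      exact (norm_add_le _ _).trans (add_le_add (le_ciSup (hb η) n) (le_ciSup (hb ζ) n)))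
    (fun c η => by
      rw [Real.mul_iSup_of_nonneg (norm_nonneg c)]
      refine iSup_congr fun n => ?_
      rw [pairing_smul_left, norm_mul])

theorem supPairing_le {g : ℕ → S} {D : ℕ → ℝ} (hD : ∀ q n : ℕ, wnorm q (g n) ≤ D q) {q : ℕ}
    {η : SDual} (hη : WMem (-q) η) : supPairing g D hD η ≤ D q * wnorm (-q) η :=
  ciSup_le fun n => by
    have h := norm_pairing_le hη ((g n).wmem _)
    rw [neg_neg] at h
    rw [mul_comm]
    exact h.trans (mul_le_mul_of_nonneg_left (hD q n) (wnorm_nonneg _ _))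

theorem le_supPairing {g : ℕ → S} {D : ℕ → ℝ} (hD : ∀ q n : ℕ, wnorm q (g n) ≤ D q)
    (η : SDual) (n : ℕ) : ‖pairing η (g n)‖ ≤ supPairing g D hD η := by
  refine le_ciSup (f := fun n => ‖pairing η (g n)‖) ?_ n
  obtain ⟨q, hq⟩ := η.exists_wmem
  refine ⟨wnorm (-q) η * D q, ?_⟩
  rintro _ ⟨n, rfl⟩
  have h := norm_pairing_le hq ((g n).wmem _)
  rw [neg_neg] at h
  exact h.trans (mul_le_mul_of_nonneg_left (hD q n) (wnorm_nonneg _ _))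

/-- A bounded subset of `s'` is equicontinuous as a set of functionals on `s`. -/
theorem exists_pairing_bound {B : Set SDual} (hB : Bornology.IsVonNBounded ℂ B) :
    ∃ (r : ℕ) (C : ℝ), 0 ≤ C ∧ ∀ η ∈ B, ∀ g : S, ‖pairing η g‖ ≤ C * wnorm r g := by
  -- Failure for r = C = n yields ηₙ in B and gₙ with |⟨ηₙ,gₙ⟩| > n|gₙ|ₙ. Normalized to |Gₙ|ₙ = 1,
  -- the vectors form a bounded sequence in s, so η ↦ sup |⟨η,Gₙ⟩| is a continuous seminorm on s';
  -- but it is unbounded on B.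
  by_contra! h
  choose η hη g hg using fun n : ℕ => h n n n.cast_nonneg
  have hpos : ∀ n : ℕ, 0 < wnorm n (g n) := fun n => by
    refine (wnorm_nonneg _ _).lt_of_ne' fun h0 => ?_
    have h1 : g n = 0 := S.eq_zero_of_wnorm_eq_zero
      (le_antisymm ((wnorm_mono (by positivity) ((g n).wmem n)).trans_eq h0) (wnorm_nonneg _ _))
    have h2 := hg n
    rw [h0, mul_zero, h1, map_zero, pairing] at h2
    simp at h2
  let G : ℕ → S := fun n => (((wnorm n (g n))⁻¹ : ℝ) : ℂ) • g n
  have hG : ∀ (q : ℤ) (n : ℕ), wnorm q (G n) = (wnorm n (g n))⁻¹ * wnorm q (g n) := fun q n => by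
    change wnorm q (S.toSeq (_ • g n)) = _
    rw [map_smul, wnorm_smul, Complex.norm_real, Real.norm_of_nonneg (inv_nonneg.2 (hpos n).le)]
  -- The constant 1 covers n ≥ q, where |Gₙ|_q ≤ |Gₙ|ₙ = 1; the sum covers the finitely many n < q.
  have hD : ∀ q n : ℕ, wnorm q (G n) ≤ 1 + ∑ k ∈ Finset.range q, wnorm q (G k) := fun q n => by
    have hs : 0 ≤ ∑ k ∈ Finset.range q, wnorm q (G k) :=
      Finset.sum_nonneg fun _ _ => wnorm_nonneg _ _
    by_cases hn : n < q
    · have := Finset.single_le_sum (f := fun k => wnorm q (G k)) (fun k _ => wnorm_nonneg _ _)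
        (Finset.mem_range.2 hn)
      linarith
    · have h1 := wnorm_mono (by exact_mod_cast not_lt.1 hn : (q : ℤ) ≤ n) ((G n).wmem n)
      rw [hG n n, inv_mul_cancel₀ (hpos n).ne'] at h1
      linarith
  have hstep : StepBounded (supPairing G _ hD) := fun q => ⟨_, fun ξ hξ => supPairing_le hD hξ⟩
  obtain ⟨R, -, hR⟩ := SDual.withSeminorms.isVonNBounded_iff_seminorm_bounded.1 hB ⟨_, hstep⟩
  obtain ⟨n, hn⟩ := exists_nat_gt R
  have h1 := (le_supPairing hD (η n) n).trans_lt (hR (η n) (hη n))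
  have h2 : pairing (η n) (G n) = (((wnorm n (g n))⁻¹ : ℝ) : ℂ) * pairing (η n) (g n) := by
    rw [← pairing_conj, ← pairing_conj (g n)]
    change conj (S.pairingCLM (η n) (_ • g n)) = _
    rw [map_smul, smul_eq_mul, map_mul, Complex.conj_ofReal]
    rfl
  rw [h2, norm_mul, Complex.norm_real, Real.norm_of_nonneg (inv_nonneg.2 (hpos n).le),
    inv_mul_lt_iff₀ (hpos n)] at h1
  have h3 := hg n
  have h4 := mul_lt_mul_of_pos_right hn (hpos n)
  linarith

/-! ### The diagonal operators of an orthonormal sequence -/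

section Diagonal

variable {f : ℕ → S} (hf : OrthonormalSeq f)

/-- Of the four norms that |fⱼ|_{4(q+r+1)} dominates, two are |fⱼ|_q and |fⱼ|_r, and the other two
are spent on |fⱼ|₁² to gain a summable factor. The index q+r+1 exceeds or equals each of q, r and 1.
-/
theorem norm_coord_mul_le {f : ℕ → S} {hf : OrthonormalSeq f} (ξ : KotheSpace (normMatrix f hf))
    (q r j : ℕ) :
    ‖ξ j‖ * (wnorm q (f j) * wnorm r (f j)) ≤
      KotheSpace.seminorms _ (4 * (q + r + 1)) ξ * (wnorm 1 (f j) ^ 2)⁻¹ := by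
  have h1 : ‖ξ j‖ * wnorm (4 * (q + r + 1) : ℕ) (f j) ≤
      KotheSpace.seminorms _ (4 * (q + r + 1)) ξ := KotheSpace.le_iSup ξ (4 * (q + r + 1)) j
  have h2 := hf.pow_four_le j (q + r + 1)
  have hM : ∀ k : ℕ, k ≤ q + r + 1 → wnorm k (f j) ≤ wnorm (q + r + 1 : ℕ) (f j) := fun k hk =>
    wnorm_mono (by exact_mod_cast hk) ((f j).wmem _)
  have hq := hM q (by lia)
  have hr := hM r (by lia)
  have h3 := hM 1 (by lia)
  have h0 := hf.one_le_wnorm j 1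
  rw [Nat.cast_one] at h3 h0
  rw [← div_eq_mul_inv, le_div_iff₀ (by positivity), mul_assoc]
  refine (mul_le_mul_of_nonneg_left (le_trans ?_ h2) (norm_nonneg _)).trans h1
  have hq0 := wnorm_nonneg q (f j)
  have hr0 := wnorm_nonneg r (f j)
  have hM0 := wnorm_nonneg (q + r + 1 : ℕ) (f j)
  calc wnorm q (f j) * wnorm r (f j) * wnorm 1 (f j) ^ 2
      ≤ wnorm (q + r + 1 : ℕ) (f j) * wnorm (q + r + 1 : ℕ) (f j) *
        wnorm (q + r + 1 : ℕ) (f j) ^ 2 := by gcongr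
    _ = _ := by ring

/-- Only the pair (r, C) enters the bound, not η itself; the estimate is thus uniform over
equicontinuous sets of functionals. -/
theorem wnorm_diagTerm_le {hf : OrthonormalSeq f} (ξ : KotheSpace (normMatrix f hf)) {η : SDual}
    {r : ℕ} {C : ℝ} (hC : 0 ≤ C) (h : ∀ j, ‖pairing η (f j)‖ ≤ C * wnorm r (f j)) (q j : ℕ) :
    wnorm q (S.toSeq ((ξ j * pairing η (f j)) • f j)) ≤
      C * KotheSpace.seminorms _ (4 * (q + r + 1)) ξ * (wnorm 1 (f j) ^ 2)⁻¹ := by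
  rw [map_smul, wnorm_smul, norm_mul]
  have h1 := mul_le_mul_of_nonneg_left (norm_coord_mul_le ξ q r j) hC
  have h2 : ‖ξ j‖ * wnorm q (f j) * ‖pairing η (f j)‖ ≤
      ‖ξ j‖ * wnorm q (f j) * (C * wnorm r (f j)) :=
    mul_le_mul_of_nonneg_left (h j) (mul_nonneg (norm_nonneg _) (wnorm_nonneg _ _))
  linarith

theorem exists_pairing_le (η : SDual) :
    ∃ (r : ℕ) (C : ℝ), 0 ≤ C ∧ ∀ g : S, ‖pairing η g‖ ≤ C * wnorm r g := by
  obtain ⟨r, hr⟩ := η.exists_wmem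
  refine ⟨r, wnorm (-r) η, wnorm_nonneg _ _, fun g => ?_⟩
  have h := norm_pairing_le hr (g.wmem _)
  rwa [neg_neg] at h

theorem summable_wnorm_diagTerm {hf : OrthonormalSeq f} (ξ : KotheSpace (normMatrix f hf))
    (η : SDual) (q : ℕ) :
    Summable fun j => wnorm q (S.toSeq ((ξ j * pairing η (f j)) • f j)) := by
  obtain ⟨r, C, hC, h⟩ := exists_pairing_le η
  exact Summable.of_nonneg_of_le (fun j => wnorm_nonneg _ _)
    (wnorm_diagTerm_le ξ hC (fun j => h (f j)) q) (hf.summable_inv_sq.mul_left _)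

theorem summable_diagTerm {hf : OrthonormalSeq f} (ξ : KotheSpace (normMatrix f hf))
    (η : SDual) : Summable fun j => (ξ j * pairing η (f j)) • f j :=
  S.summable_of_summable_wnorm (summable_wnorm_diagTerm ξ η)

/-- The linear map `η ↦ ∑ⱼ ξⱼ ⟨η, fⱼ⟩ fⱼ`. -/
def diagLin (ξ : KotheSpace (normMatrix f hf)) : SDual →ₗ[ℂ] S where
  toFun η := ∑' j, (ξ j * pairing η (f j)) • f j
  map_add' η ζ := by
    rw [← (summable_diagTerm ξ η).tsum_add (summable_diagTerm ξ ζ)]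
    exact tsum_congr fun j => by rw [pairing_add_left, mul_add, add_smul]
  map_smul' c η := by
    rw [RingHom.id_apply, ← (summable_diagTerm ξ η).tsum_const_smul c]
    exact tsum_congr fun j => by rw [pairing_smul_left, smul_smul]; congr 1; ring

theorem wnorm_diagLin_le (ξ : KotheSpace (normMatrix f hf)) {η : SDual}
    {r : ℕ} {C : ℝ} (hC : 0 ≤ C) (h : ∀ j, ‖pairing η (f j)‖ ≤ C * wnorm r (f j)) (q : ℕ) :
    wnorm q (diagLin hf ξ η) ≤ C * KotheSpace.seminorms _ (4 * (q + r + 1)) ξ *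
      ∑' j, (wnorm 1 (f j) ^ 2)⁻¹ := by
  rw [← tsum_mul_left]
  exact (S.wnorm_tsum_le (summable_wnorm_diagTerm ξ η) q).trans
    ((summable_wnorm_diagTerm ξ η q).tsum_le_tsum (wnorm_diagTerm_le ξ hC h q)
      (hf.summable_inv_sq.mul_left _))

/-- The operator `∑ⱼ ξⱼ ⟨·, fⱼ⟩ fⱼ`, which depends linearly on `ξ ∈ λ^∞(|f_k|_q)`. -/
def diag : KotheSpace (normMatrix f hf) →ₗ[ℂ] (SDual →L[ℂ] S) where
  toFun ξ := mkCLM (diagLin hf ξ) fun q r =>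
    ⟨KotheSpace.seminorms _ (4 * (q + r + 1)) ξ * ∑' j, (wnorm 1 (f j) ^ 2)⁻¹, fun η hη => by
      refine (wnorm_diagLin_le hf ξ (r := r) (wnorm_nonneg (-r) η) (fun j => ?_) q).trans_eq
        (by ring)
      have h := norm_pairing_le hη ((f j).wmem _)
      rwa [neg_neg] at h⟩
  map_add' ξ ζ := ContinuousLinearMap.ext fun η => by
    refine Eq.trans ?_ ((summable_diagTerm ξ η).tsum_add (summable_diagTerm ζ η))
    exact tsum_congr fun j => by rw [map_add, Pi.add_apply, add_mul, add_smul]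
  map_smul' c ξ := ContinuousLinearMap.ext fun η => by
    refine Eq.trans ?_ ((summable_diagTerm ξ η).tsum_const_smul c)
    exact tsum_congr fun j => by rw [map_smul, Pi.smul_apply, smul_eq_mul, smul_smul, mul_assoc]

theorem diag_apply (ξ : KotheSpace (normMatrix f hf)) (η : SDual) :
    diag hf ξ η = ∑' j, (ξ j * pairing η (f j)) • f j := rfl

theorem diag_apply_self (ξ : KotheSpace (normMatrix f hf)) (k : ℕ) :
    diag hf ξ (incl (f k)) = ξ k • f k := by
  have h : ∀ j, pairing (incl (f k)) (f j) = if k = j then 1 else 0 := fun j => hf k j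
  rw [diag_apply, tsum_eq_single k fun j hj => by rw [h, if_neg hj.symm, mul_zero, zero_smul]]
  rw [h, if_pos rfl, mul_one]

theorem diag_apply_of_orthogonal (ξ : KotheSpace (normMatrix f hf)) {η : SDual}
    (h : ∀ j, pairing η (f j) = 0) : diag hf ξ η = 0 := by
  rw [diag_apply]
  simp only [h, mul_zero, zero_smul, tsum_zero]

theorem diag_unit (k : ℕ) : diag hf (KotheSpace.unit _ k) = rankOne (f k) := by
  ext1 η
  have h : ∀ j, (KotheSpace.unit (normMatrix f hf) k) j = if j = k then 1 else 0 := fun j =>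
    Pi.single_apply ..
  rw [diag_apply, tsum_eq_single k fun j hj => by rw [h, if_neg hj, zero_mul, zero_smul],
    h, if_pos rfl, one_mul]
  rfl

theorem diag_injective : Function.Injective (diag hf) := by
  intro ξ ζ h
  refine KotheSpace.ext fun j => ?_
  have h1 := DFunLike.congr_fun h (incl (f j))
  rw [diag_apply_self, diag_apply_self] at h1
  have h2 := congrArg (S.pairingCLM (incl (f j))) h1
  have h3 : S.pairingCLM (incl (f j)) (f j) = 1 := (hf j j).trans (if_pos rfl)
  simpa [h3] using h2

theorem diag_mul (ξ ζ : KotheSpace (normMatrix f hf)) :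
    diag hf (ξ * ζ) = diag hf ξ * diag hf ζ := by
  refine clm_ext_family f (fun j => ?_) fun g hg => ?_
  · rw [mul_apply, diag_apply_self, diag_apply_self, map_smul, map_smul, diag_apply_self,
      KotheSpace.mul_apply, smul_smul, mul_comm]
  · have h : ∀ j, pairing (L2.toDual g) (f j) = 0 := hg
    rw [mul_apply, diag_apply_of_orthogonal hf _ h, diag_apply_of_orthogonal hf _ h, map_zero,
      map_zero]

theorem pairing_diag (ξ : KotheSpace (normMatrix f hf)) (η ζ : SDual) :
    pairing (diag hf ξ η) ζ = ∑' j, ξ j * pairing η (f j) * pairing (f j) ζ := by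
  rw [← S.pairingCLM_apply, diag_apply, (S.pairingCLM ζ).map_tsum (summable_diagTerm ξ η)]
  exact tsum_congr fun j => by rw [map_smul, smul_eq_mul, S.pairingCLM_apply]

theorem diag_star (ξ : KotheSpace (normMatrix f hf)) :
    diag hf (star ξ) = star (diag hf ξ) := by
  refine eq_star_of_pairing fun i η => ?_
  rw [← pairing_conj _ (SDual.toSeq (SDual.unit i)), pairing_diag, pairing_diag, Complex.conj_tsum]
  refine tsum_congr fun j => ?_
  rw [map_mul, map_mul, pairing_conj, pairing_conj, KotheSpace.star_apply, Complex.conj_conj]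
  ring

/-- The `*`-homomorphism `ξ ↦ ∑ⱼ ξⱼ ⟨·, fⱼ⟩ fⱼ` from `λ^∞(|f_k|_q)` to `L(s', s)`. -/
def diagHom : KotheSpace (normMatrix f hf) →⋆ₙₐ[ℂ] (SDual →L[ℂ] S) where
  toFun := diag hf
  map_smul' c ξ := map_smul (diag hf) c ξ
  map_zero' := map_zero (diag hf)
  map_add' := map_add (diag hf)
  map_mul' := diag_mul hf
  map_star' := diag_star hf

/-- The eigenvalue sequence of an operator for which all `fⱼ` are eigenvectors belongs to
`λ^∞(|f_k|_q)`. -/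
theorem bddAbove_eigenvalues {x : SDual →L[ℂ] S} {c : ℕ → ℂ}
    (hc : ∀ j, c j = 0 ∨ x (incl (f j)) = c j • f j) (q : ℕ) :
    BddAbove (Set.range fun j => ‖c j‖ * (normMatrix f hf).entry j q) := by
  -- Since |fⱼ|₀ = 1, evaluation at fⱼ bounds |cⱼ||fⱼ|_q by a constant independent of j. The
  -- alternative `c j = 0` admits indices at which fⱼ is not known to be an eigenvector.
  obtain ⟨C, hC0, hC⟩ := bound_of_clm x q 0
  refine ⟨C, ?_⟩
  rintro _ ⟨j, rfl⟩
  change ‖c j‖ * wnorm q (f j) ≤ C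
  rcases hc j with h | h
  · rw [h, norm_zero, zero_mul]; exact hC0
  · have h1 := hC (incl (f j)) ((f j).wmem _)
    rw [h, map_smul, wnorm_smul] at h1
    have h2 : wnorm (-(0 : ℕ)) (SDual.toSeq (incl (f j))) = 1 := by
      rw [Nat.cast_zero, neg_zero]; exact hf.wnorm_zero j
    rwa [h2, mul_one] at h1

/-- Both conditions are equations between continuous functions of x, which makes the range closed;
they are also what simultaneous diagonalization delivers. -/
theorem mem_range_diag_iff (x : SDual →L[ℂ] S) :
    x ∈ Set.range (diag hf) ↔
      (∀ j, x (incl (f j)) = pairing (x (incl (f j))) (f j) • f j) ∧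
      ∀ g : L2, (∀ j, pairing g (f j) = 0) → x (L2.toDual g) = 0 := by
  constructor
  · rintro ⟨ξ, rfl⟩
    refine ⟨fun j => ?_, fun g hg => diag_apply_of_orthogonal hf ξ hg⟩
    rw [diag_apply_self]
    congr 1
    have h3 : S.pairingCLM (incl (f j)) (f j) = 1 := (hf j j).trans (if_pos rfl)
    have h2 : S.pairingCLM (incl (f j)) (ξ j • f j) = ξ j := by
      rw [map_smul, h3, smul_eq_mul, mul_one]
    exact h2.symm
  · rintro ⟨h1, h2⟩
    refine ⟨KotheSpace.mk _ (bddAbove_eigenvalues hf fun j => Or.inr (h1 j)), ?_⟩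
    refine clm_ext_family f (fun j => ?_) fun g hg => ?_
    · rw [diag_apply_self, KotheSpace.toSeq_mk, ← h1 j]
    · rw [h2 g hg]
      exact diag_apply_of_orthogonal hf _ hg

theorem isClosed_range_diag : IsClosed (Set.range (diag hf)) := by
  have : Set.range (diag hf) =
      (⋂ j, {x | x (incl (f j)) = S.pairingCLM (incl (f j)) (x (incl (f j))) • f j}) ∩
      ⋂ g : {g : L2 // ∀ j, pairing g (f j) = 0}, {x | x (L2.toDual g.1) = 0} := by
    ext x
    rw [mem_range_diag_iff]
    simp only [Set.mem_inter_iff, Set.mem_iInter, Set.mem_ofPred_eq, Subtype.forall]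
    rfl
  rw [this]
  refine (isClosed_iInter fun j => isClosed_eq (continuous_eval_const _) ?_).inter
    (isClosed_iInter fun g => isClosed_eq (continuous_eval_const _) continuous_const)
  exact ((S.pairingCLM _).continuous.comp (continuous_eval_const _)).smul continuous_const

/-- A bounded set of s' shares one pair (r, C), so a single seminorm of ξ controls |`diag hf ξ η`|_q
uniformly over that set. -/
theorem continuous_diag : Continuous (diag hf) := by
  refine continuous_of_continuousAt_zero (diag hf) ?_
  rw [ContinuousAt, map_zero, (ContinuousLinearMap.hasBasis_nhds_zero_of_basis
    S.withSeminorms.hasBasis_zero_ball).tendsto_right_iff]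
  rintro ⟨B, s, ε⟩ ⟨hB, hε⟩
  obtain ⟨r, C, hC0, hC⟩ := exists_pairing_bound hB
  have h : ∀ q ∈ s, ∀ᶠ ξ in nhds (0 : KotheSpace (normMatrix f hf)),
      C * KotheSpace.seminorms _ (4 * (q + r + 1)) ξ * ∑' j, (wnorm 1 (f j) ^ 2)⁻¹ < ε := by
    intro q _
    have hc : Continuous fun ξ : KotheSpace (normMatrix f hf) =>
        C * KotheSpace.seminorms _ (4 * (q + r + 1)) ξ * ∑' j, (wnorm 1 (f j) ^ 2)⁻¹ :=
      (continuous_const.mul (KotheSpace.withSeminorms.continuous_seminorm _)).mul continuous_const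
    refine (hc.tendsto 0).eventually (gt_mem_nhds ?_)
    rwa [map_zero, mul_zero, zero_mul]
  filter_upwards [(Filter.eventually_all_finset s).2 h] with ξ hξ
  intro η hη
  rw [Seminorm.mem_ball_zero]
  refine Seminorm.finset_sup_apply_lt hε fun q hq => ?_
  exact (wnorm_diagLin_le hf ξ hC0 (fun j => hC η hη (f j)) q).trans_lt (hξ q hq)

theorem OrthonormalSeq.isVonNBounded_range {f : ℕ → S} (hf : OrthonormalSeq f) :
    Bornology.IsVonNBounded ℂ (Set.range fun j => incl (f j)) := by
  refine SDual.withSeminorms.isVonNBounded_iff_seminorm_bddAbove.2 fun p => ?_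
  obtain ⟨C, hC⟩ := p.2 0
  refine ⟨C, ?_⟩
  rintro _ ⟨_, ⟨j, rfl⟩, rfl⟩
  have h1 := hC (incl (f j)) ((f j).wmem _)
  have h2 : wnorm (-(0 : ℕ)) (SDual.toSeq (incl (f j))) = 1 := by
    rw [Nat.cast_zero, neg_zero]; exact hf.wnorm_zero j
  rwa [h2, mul_one] at h1

/-- For the inverse: the operator sends fⱼ to ξⱼfⱼ and the fⱼ form a bounded set of s', so uniform
smallness there bounds supⱼ |ξⱼ||fⱼ|_q. -/
theorem isClosedEmbedding_diag : Topology.IsClosedEmbedding (diag hf) := by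
  refine ⟨⟨?_, diag_injective hf⟩, isClosed_range_diag hf⟩
  rw [IsTopologicalAddGroup.isInducing_iff_nhds_zero]
  refine le_antisymm ?_ ?_
  · have h := (continuous_diag hf).tendsto 0
    rw [map_zero] at h
    exact h.le_comap
  · rw [KotheSpace.withSeminorms.hasBasis_zero_ball.ge_iff]
    rintro ⟨s, ε⟩ hε
    -- Passing to the supremum over j loses strictness; the factor 1/2 restores it.
    have hε2 : 0 < ε / 2 := half_pos hε
    have hball : (s.sup sNorm).ball 0 (ε / 2) ∈ nhds (0 : S) :=
      S.withSeminorms.hasBasis_zero_ball.mem_of_mem (i := (s, ε / 2)) hε2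
    refine ⟨_, ContinuousLinearMap.eventually_nhds_zero_mapsTo hf.isVonNBounded_range hball,
      fun ξ hξ => ?_⟩
    rw [Seminorm.mem_ball_zero]
    refine Seminorm.finset_sup_apply_lt hε fun q hq => ?_
    refine lt_of_le_of_lt (ciSup_le fun j => ?_) (half_lt_self hε)
    have h1 : diag hf ξ (incl (f j)) ∈ (s.sup sNorm).ball 0 (ε / 2) := hξ ⟨j, rfl⟩
    rw [Seminorm.mem_ball_zero, diag_apply_self] at h1
    have h2 := (Seminorm.le_finset_sup_apply (p := sNorm) hq (x := ξ j • f j)).trans h1.le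
    rwa [map_smul_eq_mul] at h2

end Diagonal

/-! ### Joint eigenvectors -/

/-- A commuting family of operators that preserves a nonzero finite-dimensional subspace has a
joint eigenvector in it. -/
theorem exists_joint_eigenvector {V ι : Type*} [AddCommGroup V] [Module ℂ V]
    (T : ι → Module.End ℂ V) (hT : ∀ i j, Commute (T i) (T j)) (K : Submodule ℂ V)
    [FiniteDimensional ℂ K] (hK : K ≠ ⊥) (hinv : ∀ i, ∀ v ∈ K, T i v ∈ K) :
    ∃ v ∈ K, v ≠ 0 ∧ ∀ i, ∃ c : ℂ, T i v = c • v := by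
  generalize hn : Module.finrank ℂ K = n
  induction n using Nat.strong_induction_on generalizing K with
  | _ n ih =>
    -- If some `T i` is not scalar on K, one of its eigenspaces meets K in a proper nonzero
    -- subspace, invariant by commutation, and the dimension drops.
    by_cases hall : ∀ i, ∃ c : ℂ, ∀ v ∈ K, T i v = c • v
    · obtain ⟨v, hv, hv0⟩ := K.ne_bot_iff.1 hK
      exact ⟨v, hv, hv0, fun i => (hall i).imp fun c hc => hc v hv⟩
    · push Not at hall
      obtain ⟨i, hi⟩ := hall
      have : Nontrivial K := (Submodule.nontrivial_iff_ne_bot).2 hK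
      obtain ⟨μ, hμ⟩ := Module.End.exists_eigenvalue ((T i).restrict (hinv i))
      obtain ⟨w, hw⟩ := hμ.exists_hasEigenvector
      have hw1 : T i w = μ • (w : V) := congrArg Subtype.val hw.apply_eq_smul
      obtain ⟨u, huK, hu⟩ := hi μ
      have hlt : K ⊓ (T i).eigenspace μ < K := by
        refine inf_le_left.lt_of_ne fun h => hu ?_
        have : u ∈ K ⊓ (T i).eigenspace μ := h.symm ▸ huK
        exact Module.End.mem_eigenspace_iff.1 this.2
      have : FiniteDimensional ℂ ↥(K ⊓ (T i).eigenspace μ) :=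
        Submodule.finiteDimensional_of_le inf_le_left
      obtain ⟨v, hv, h⟩ := ih _ (hn ▸ Submodule.finrank_lt_finrank_of_lt hlt)
        (K ⊓ (T i).eigenspace μ)
        ((Submodule.ne_bot_iff _).2 ⟨w, ⟨w.2, Module.End.mem_eigenspace_iff.2 hw1⟩,
          fun h => hw.2 (Subtype.ext h)⟩)
        (fun j v hv => ⟨hinv j v hv.1, by
          rw [SetLike.mem_coe, Module.End.mem_eigenspace_iff, ← Module.End.mul_apply, hT i j, Module.End.mul_apply,
            Module.End.mem_eigenspace_iff.1 hv.2, map_smul]⟩) rfl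
      exact ⟨v, hv.1, h⟩

section Joint

variable {E : NonUnitalStarSubalgebra ℂ (SDual →L[ℂ] S)}

/-- The vectors of `s` that are eigenvectors of every operator of `E`. -/
def JointEigen (E : NonUnitalStarSubalgebra ℂ (SDual →L[ℂ] S)) (v : S) : Prop :=
  ∀ y ∈ E, ∃ c : ℂ, y (incl v) = c • v

theorem JointEigen.smul {v : S} (h : JointEigen E v) (a : ℂ) : JointEigen E (a • v) :=
  fun y hy => by
    obtain ⟨c, hc⟩ := h y hy
    exact ⟨c, by rw [map_smul, map_smul, hc, smul_comm]⟩

/-- On W the operator x*x is compact, symmetric and nonzero, as ⟨x*xw,w⟩ = ‖xw‖². It therefore has a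
finite-dimensional eigenspace for some μ ≠ 0, which E preserves by commutativity and in which a
joint eigenvector exists. -/
theorem exists_jointEigen_mem (hE : ∀ x ∈ E, ∀ y ∈ E, x * y = y * x) (W : Submodule ℂ L2)
    (hWc : IsClosed (W : Set L2)) (hW : ∀ x ∈ E, ∀ w ∈ W, hat x w ∈ W)
    {x : SDual →L[ℂ] S} (hx : x ∈ E) {w : L2} (hw : w ∈ W) (hxw : hat x w ≠ 0) :
    ∃ v : S, v ≠ 0 ∧ S.toL2 v ∈ W ∧ JointEigen E v := by
  have : CompleteSpace W := hWc.completeSpace_coe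
  have hy : star x * x ∈ E := mul_mem (star_mem hx) hx
  let A : W →L[ℂ] W := (hat (star x * x)).restrict (hW _ hy)
  have hAapp : ∀ u : W, (A u : L2) = hat (star x * x) u := fun u => rfl
  have hAc : IsCompactOperator A := (isCompactOperator_hat (star x * x)).restrict' (hW _ hy)
  have hsymm : ∀ u v : L2, inner ℂ (hat (star x * x) u) v = inner ℂ u (hat (star x * x) v) :=
    fun u v => by rw [inner_hat, star_mul, star_star]
  have hAs : A.IsSymmetric := fun u v => hsymm u v
  have hA0 : A ≠ 0 := fun h => hxw <| by
    have h1 : hat (star x * x) w = 0 := by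
      rw [← hAapp ⟨w, hw⟩, h]; rfl
    rw [hat_mul] at h1
    rw [← inner_self_eq_zero (𝕜 := ℂ), inner_hat, h1, inner_zero_right]
  have h1 := mt (ContinuousLinearMap.eq_zero_of_forall_hasEigenvalue_eq_zero hAc hAs).1 hA0
  push Not at h1
  obtain ⟨μ, hμ, hμ0⟩ := h1
  have hfd := ContinuousLinearMap.finite_dimensional_eigenspace hAc μ hμ0
  let T : E → Module.End ℂ W := fun y => (hat y.1).toLinearMap.restrict (hW _ y.2)
  have hTapp : ∀ (y : E) (u : W), (T y u : L2) = hat y.1 u := fun _ _ => rfl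
  have hcomm : ∀ y ∈ E, ∀ z ∈ E, ∀ u, hat y (hat z u) = hat z (hat y u) := fun y hy z hz u => by
    rw [← hat_mul, ← hat_mul, hE y hy z hz]
  obtain ⟨v, hvK, hv0, hv⟩ := exists_joint_eigenvector T
    (fun y z => LinearMap.ext fun u => Subtype.ext (hcomm _ y.2 _ z.2 u))
    (Module.End.eigenspace A.toLinearMap μ) hμ (fun y u hu => by
      rw [Module.End.mem_eigenspace_iff] at hu ⊢
      have hu' : hat (star x * x) u = μ • (u : L2) := congrArg Subtype.val hu
      refine Subtype.ext ?_
      change hat (star x * x) (hat y.1 u) = μ • hat y.1 u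
      rw [hcomm _ hy _ y.2, hu', map_smul])
  have hv1 : hat (star x * x) v = μ • (v : L2) :=
    congrArg Subtype.val (Module.End.mem_eigenspace_iff.1 hvK)
  -- The eigenvector is a value of an operator into s, up to the factor μ⁻¹, and so belongs to s.
  have hv2 : S.toL2 (μ⁻¹ • (star x * x) (L2.toDual v)) = v := by
    rw [map_smul, ← hat_apply, hv1, smul_smul, inv_mul_cancel₀ hμ0, one_smul]
  refine ⟨μ⁻¹ • (star x * x) (L2.toDual v), fun h => hv0 ?_, ?_, fun y hy => ?_⟩
  · rw [h, map_zero] at hv2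
    exact Subtype.ext hv2.symm
  · rw [hv2]; exact v.2
  · obtain ⟨c, hc⟩ := hv ⟨y, hy⟩
    refine ⟨c, S.toL2_injective ?_⟩
    rw [← toDual_toL2, ← hat_apply, map_smul S.toL2 c, hv2]
    exact congrArg Subtype.val hc

theorem linearIndependent_unit : LinearIndependent ℂ S.unit :=
  LinearIndependent.of_comp S.toSeq (Pi.linearIndependent_single_one ℕ ℂ)

/-- The space s is infinite-dimensional, so finitely many functionals have a common nonzero zero. -/
theorem exists_toL2_orthogonal {V : Set L2} (hV : V.Finite) :
    ∃ u : S, u ≠ 0 ∧ ∀ v ∈ V, inner ℂ v (S.toL2 u) = 0 := by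
  by_contra! h
  have := hV.to_subtype
  let T : S →ₗ[ℂ] (V → ℂ) := LinearMap.pi fun v => (innerₛₗ ℂ v.1) ∘ₗ S.toL2
  have hT : Function.Injective T := by
    rw [injective_iff_map_eq_zero]
    intro u hu
    by_contra hu0
    obtain ⟨v, hv, hne⟩ := h u hu0
    exact hne (congrFun hu ⟨v, hv⟩)
  have : Module.Finite ℂ S := Module.Finite.of_injective T hT
  exact not_finite_iff_infinite.2 (inferInstance : Infinite ℕ) linearIndependent_unit.finite

/-- Every element has some nonzero coordinate, and by Bessel only countably many have a nonzero i-th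
one. -/
theorem countable_of_orthonormal {V : Set L2} (hV : Orthonormal ℂ (Subtype.val : V → L2)) :
    V.Countable := by
  have h : V ⊆ ⋃ i : ℕ, Subtype.val '' Function.support fun v : V =>
      ‖inner ℂ (v : L2) (S.toL2 (S.unit i))‖ ^ 2 := by
    intro v hv
    have hne : v ≠ 0 := hV.ne_zero ⟨v, hv⟩
    have : ∃ i, v i ≠ 0 := by
      by_contra! h0
      exact hne (Subtype.ext (funext h0))
    obtain ⟨i, hi⟩ := this
    refine Set.mem_iUnion.2 ⟨i, ⟨v, hv⟩, ?_, rfl⟩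
    rw [Function.mem_support, norm_inner_symm, ← pairing_eq_inner]
    have h1 : pairing v (S.toL2 (S.unit i)) = v i := pairing_single_right _ _
    rw [h1]
    exact pow_ne_zero _ (norm_ne_zero_iff.2 hi)
  exact (Set.countable_iUnion fun i =>
    (hV.inner_products_summable _).countable_support.image _).mono h

theorem mem_orthogonal_span_iff {V : Set L2} {w : L2} :
    w ∈ (Submodule.span ℂ V)ᗮ ↔ ∀ v ∈ V, inner ℂ v w = 0 := by
  refine ⟨fun h v hv => h v (Submodule.subset_span hv), fun h v hv => ?_⟩
  induction hv using Submodule.span_induction with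
  | mem v hv => exact h v hv
  | zero => exact inner_zero_left _
  | add u v _ _ hu hv => rw [inner_add_left, hu, hv, add_zero]
  | smul c v _ hv => rw [inner_smul_left, hv, mul_zero]

/-- A maximal orthonormal set of joint eigenvectors. -/
theorem exists_maximal_jointEigen (E : NonUnitalStarSubalgebra ℂ (SDual →L[ℂ] S)) :
    ∃ V : Set L2, Orthonormal ℂ (Subtype.val : V → L2) ∧
      (∀ v ∈ V, ∃ u : S, S.toL2 u = v ∧ JointEigen E u) ∧
      ∀ u : S, JointEigen E u → (∀ v ∈ V, inner ℂ v (S.toL2 u) = 0) → u = 0 := by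
  obtain ⟨V, hV⟩ := zorn_subset {V : Set L2 | Orthonormal ℂ (Subtype.val : V → L2) ∧
      ∀ v ∈ V, ∃ u : S, S.toL2 u = v ∧ JointEigen E u} fun c hc hcc =>
    ⟨⋃₀ c, ⟨orthonormal_sUnion_of_directed hcc.directedOn fun a ha => (hc ha).1,
      fun v ⟨a, ha, hva⟩ => (hc ha).2 v hva⟩, fun s hs => Set.subset_sUnion_of_mem hs⟩
  refine ⟨V, hV.1.1, hV.1.2, fun u hu huV => ?_⟩
  by_contra hu0
  have hn : ‖S.toL2 u‖ ≠ 0 := norm_ne_zero_iff.2 fun h =>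
    hu0 (S.toL2_injective (h.trans (map_zero _).symm))
  let a : ℂ := ((‖S.toL2 u‖⁻¹ : ℝ) : ℂ)
  have hw1 : inner ℂ (S.toL2 (a • u)) (S.toL2 (a • u)) = 1 := by
    have : ‖S.toL2 (a • u)‖ = 1 := by
      rw [map_smul, norm_smul, Complex.norm_real, norm_inv, norm_norm, inv_mul_cancel₀ hn]
    rw [inner_self_eq_norm_sq_to_K, this]
    simp
  have hwV : ∀ v ∈ V, inner ℂ v (S.toL2 (a • u)) = 0 := fun v hv => by
    rw [map_smul, inner_smul_right, huV v hv, mul_zero]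
  have hwnot : S.toL2 (a • u) ∉ V := fun h => by
    have := hwV _ h
    rw [hw1] at this
    exact one_ne_zero this
  have hins : insert (S.toL2 (a • u)) V ∈ {V : Set L2 | Orthonormal ℂ (Subtype.val : V → L2) ∧
      ∀ v ∈ V, ∃ u : S, S.toL2 u = v ∧ JointEigen E u} := by
    classical
    refine ⟨orthonormal_subtype_iff_ite.2 ?_, ?_⟩
    · have hVi := orthonormal_subtype_iff_ite.1 hV.1.1
      rintro v (rfl | hv) w (rfl | hw)
      · rw [hw1, if_pos rfl]
      · rw [← inner_conj_symm, hwV w hw, map_zero, if_neg]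
        rintro rfl; exact hwnot hw
      · rw [hwV v hv, if_neg]
        rintro rfl; exact hwnot hv
      · exact hVi v hv w hw
    · rintro v (rfl | hv)
      · exact ⟨_, rfl, hu.smul a⟩
      · exact hV.1.2 v hv
  exact hwnot (hV.2 hins (Set.subset_insert _ _) (Set.mem_insert _ _))

/-- The operators of a commutative `*`-subalgebra of `L(s', s)` are simultaneously diagonal with
respect to an orthonormal sequence in `s`. -/
theorem exists_subset_range_diag (hE : ∀ x ∈ E, ∀ y ∈ E, x * y = y * x) :
    ∃ (f : ℕ → S) (hf : OrthonormalSeq f), (E : Set (SDual →L[ℂ] S)) ⊆ Set.range (diag hf) := by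
  obtain ⟨V, hVo, hVE, hmax⟩ := exists_maximal_jointEigen E
  have hinv : ∀ x ∈ E, ∀ w ∈ (Submodule.span ℂ V)ᗮ, hat x w ∈ (Submodule.span ℂ V)ᗮ := by
    intro x hx w hw
    rw [mem_orthogonal_span_iff] at hw ⊢
    intro v hv
    obtain ⟨u, rfl, hu⟩ := hVE v hv
    obtain ⟨c, hc⟩ := hu (star x) (star_mem hx)
    have h1 : hat (star x) (S.toL2 u) = c • S.toL2 u := by
      rw [hat_apply, toDual_toL2, hc, map_smul]
    have h2 := inner_hat (star x) (S.toL2 u) w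
    rw [star_star, h1, inner_smul_left, hw _ hv, mul_zero] at h2
    exact h2.symm
  have hzero : ∀ x ∈ E, ∀ w ∈ (Submodule.span ℂ V)ᗮ, hat x w = 0 := by
    intro x hx w hw
    by_contra hne
    obtain ⟨v, hv0, hvW, hv⟩ := exists_jointEigen_mem hE _ (Submodule.isClosed_orthogonal _) hinv
      hx hw hne
    exact hv0 (hmax v hv (mem_orthogonal_span_iff.1 hvW))
  -- Were V finite, a nonzero u in s orthogonal to V would be killed by E; it would be a joint
  -- eigenvector with eigenvalue 0, against maximality. Thus V is infinite even when E is
  -- finite-dimensional.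
  have hinf : V.Infinite := fun hfin => by
    obtain ⟨u, hu0, hu⟩ := exists_toL2_orthogonal hfin
    refine hu0 (hmax u (fun x hx => ⟨0, ?_⟩) hu)
    have := hzero x hx _ (mem_orthogonal_span_iff.2 hu)
    rw [hat_apply, toDual_toL2] at this
    rw [zero_smul]
    exact S.toL2_injective (this.trans (map_zero _).symm)
  obtain ⟨hden⟩ := (Set.countable_infinite_iff_nonempty_denumerable).1
    ⟨countable_of_orthonormal hVo, hinf⟩
  let e : ℕ ≃ V := (Denumerable.eqv V).symm
  choose f hfV hfE using fun n => hVE (e n) (e n).2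
  have hf : OrthonormalSeq f := fun i j => by
    have h1 := (orthonormal_iff_ite.1 (hVo.comp e e.injective)) j i
    simp only [Function.comp_apply] at h1
    rw [← hfV, ← hfV, ← pairing_eq_inner] at h1
    refine h1.trans ?_
    simp only [eq_comm]
  refine ⟨f, hf, fun x hx => (mem_range_diag_iff hf x).2 ⟨fun j => ?_, fun g hg => ?_⟩⟩
  · obtain ⟨c, hc⟩ := hfE j x hx
    have h3 : S.pairingCLM (incl (f j)) (f j) = 1 := (hf j j).trans (if_pos rfl)
    have h2 : S.pairingCLM (incl (f j)) (c • f j) = c := by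
      rw [map_smul, h3, smul_eq_mul, mul_one]
    rw [hc]
    exact congrArg (· • f j) h2.symm
  · refine S.toL2_injective (Eq.trans (hzero x hx g (mem_orthogonal_span_iff.2 fun v hv => ?_))
      (map_zero _).symm)
    have h1 := hg (e.symm ⟨v, hv⟩)
    have h2 : S.toL2 (f (e.symm ⟨v, hv⟩)) = v := by rw [hfV, Equiv.apply_symm_apply]
    rw [← h2, ← pairing_eq_inner]
    exact h1

end Joint

/-! ### Projections in closed `*`-subalgebras of `λ^∞(|f_k|_q)` -/

section Projections

open Filter Topology

variable {f : ℕ → S} {hf : OrthonormalSeq f}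

/-- The summable factor |fⱼ|₁⁻² upgrades boundedness for all q to decay for all q. Finiteness of
projections and dominated convergence both depend on this. -/
theorem tendsto_coord (ξ : KotheSpace (normMatrix f hf)) (q : ℕ) :
    Tendsto (fun j => ‖ξ j‖ * (normMatrix f hf).entry j q) cofinite (𝓝 0) := by
  have h := (hf.summable_inv_sq.mul_left
    (KotheSpace.seminorms _ (4 * (q + 0 + 1)) ξ)).tendsto_cofinite_zero
  refine squeeze_zero (fun j => mul_nonneg (norm_nonneg _) ((normMatrix f hf).nonneg j q))
    (fun j => ?_) h
  have h1 := norm_coord_mul_le ξ q 0 j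
  rw [Nat.cast_zero, hf.wnorm_zero, mul_one] at h1
  exact h1

theorem finite_setOf_le_norm (ξ : KotheSpace (normMatrix f hf)) {ε : ℝ} (hε : 0 < ε) :
    {j | ε ≤ ‖ξ j‖}.Finite := by
  have h := (tendsto_coord ξ 0).eventually (gt_mem_nhds hε)
  refine (Filter.eventually_cofinite.1 h).subset fun j hj => ?_
  have h1 : ‖ξ j‖ ≤ ‖ξ j‖ * (normMatrix f hf).entry j 0 :=
    le_mul_of_one_le_right (norm_nonneg _) (hf.one_le j 0)
  exact not_lt.2 (le_trans hj h1)

/-- Dominated convergence in `λ^∞(|f_k|_q)`. -/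
theorem tendsto_of_dominated {u : ℕ → KotheSpace (normMatrix f hf)}
    {v : KotheSpace (normMatrix f hf)} (ζ : KotheSpace (normMatrix f hf))
    (h : ∀ n j, ‖u n j - v j‖ ≤ ‖ζ j‖)
    (hp : ∀ j, Tendsto (fun n => u n j) atTop (𝓝 (v j))) : Tendsto u atTop (𝓝 v) := by
  refine (KotheSpace.withSeminorms.tendsto_nhds u v).2 fun q ε hε => ?_
  have hfin := Filter.eventually_cofinite.1
    ((tendsto_coord ζ q).eventually (gt_mem_nhds (half_pos hε)))
  have hev : ∀ j ∈ {j | ¬ ‖ζ j‖ * (normMatrix f hf).entry j q < ε / 2},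
      ∀ᶠ n in atTop, ‖u n j - v j‖ * (normMatrix f hf).entry j q < ε / 2 := fun j _ => by
    have h1 := (tendsto_iff_norm_sub_tendsto_zero.1 (hp j)).mul_const
      ((normMatrix f hf).entry j q)
    rw [zero_mul] at h1
    exact h1.eventually (gt_mem_nhds (half_pos hε))
  filter_upwards [(Filter.eventually_all_finite hfin).2 hev] with n hn
  refine lt_of_le_of_lt (ciSup_le fun j => ?_) (half_lt_self hε)
  rw [map_sub, Pi.sub_apply]
  by_cases hj : ‖ζ j‖ * (normMatrix f hf).entry j q < ε / 2
  · exact (mul_le_mul_of_nonneg_right (h n j) ((normMatrix f hf).nonneg j q)).trans hj.le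
  · exact (hn j hj).le

variable (hf) in
/-- The indicator function of a finite set, as an element of `λ^∞(|f_k|_q)`. -/
def ind (A : Finset ℕ) : KotheSpace (normMatrix f hf) := ∑ j ∈ A, KotheSpace.unit _ j

theorem ind_apply (A : Finset ℕ) (i : ℕ) : ind hf A i = if i ∈ A then 1 else 0 := by
  rw [ind, map_sum, Finset.sum_apply]
  change ∑ j ∈ A, (Pi.single j 1 : ℕ → ℂ) i = _
  simp [Pi.single_apply]

theorem ind_ne_zero {A : Finset ℕ} (hA : A.Nonempty) : ind hf A ≠ 0 := fun h => by
  obtain ⟨a, ha⟩ := hA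
  have h1 := congrFun (congrArg KotheSpace.toSeq h) a
  rw [ind_apply, if_pos ha, map_zero] at h1
  exact one_ne_zero h1

theorem isStarProjection_ind (A : Finset ℕ) : IsStarProjection (ind hf A) where
  isIdempotentElem := KotheSpace.ext fun j => by
    rw [KotheSpace.mul_apply, ind_apply]; split_ifs <;> simp
  isSelfAdjoint := KotheSpace.ext fun j => by
    rw [KotheSpace.star_apply, ind_apply]; split_ifs <;> simp

theorem IsStarProjection.eq_ind {P : KotheSpace (normMatrix f hf)} (hP : IsStarProjection P) :
    ∃ A : Finset ℕ, P = ind hf A := by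
  have h01 : ∀ j, P j = 0 ∨ P j = 1 := fun j => by
    have h : P j * P j = P j := congrFun (congrArg KotheSpace.toSeq hP.isIdempotentElem.eq) j
    rcases eq_or_ne (P j) 0 with h0 | h0
    · exact Or.inl h0
    · exact Or.inr (mul_left_cancel₀ h0 (h.trans (mul_one _).symm))
  refine ⟨(finite_setOf_le_norm P one_pos).toFinset, KotheSpace.ext fun j => ?_⟩
  rw [ind_apply]
  rcases h01 j with h | h <;> simp [h]

variable {F : NonUnitalStarSubalgebra ℂ (KotheSpace (normMatrix f hf))}

/-- A closed `*`-subalgebra contains the indicator function of the set where `|ξ|` is maximal,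
for each of its nonzero elements `ξ`. -/
theorem exists_ind_mem (hF : IsClosed (F : Set (KotheSpace (normMatrix f hf))))
    {ξ : KotheSpace (normMatrix f hf)} (hξ : ξ ∈ F) (h0 : ξ ≠ 0) :
    ∃ A : Finset ℕ, A.Nonempty ∧ ind hf A ∈ F ∧ ∀ j ∈ A, ξ j ≠ 0 := by
  obtain ⟨i, hi⟩ : ∃ i, ξ i ≠ 0 := by
    by_contra! h
    exact h0 (KotheSpace.ext h)
  have hi' : 0 < ‖ξ i‖ := norm_pos_iff.2 hi
  obtain ⟨a, ha, hmax'⟩ := Set.exists_max_image _ (fun j => ‖ξ j‖)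
    (finite_setOf_le_norm ξ hi') ⟨i, le_refl ‖ξ i‖⟩
  have ha0 : 0 < ‖ξ a‖ := hi'.trans_le ha
  have hmax : ∀ j, ‖ξ j‖ ≤ ‖ξ a‖ := fun j => by
    by_cases hj : ‖ξ i‖ ≤ ‖ξ j‖
    · exact hmax' j hj
    · exact (not_le.1 hj).le.trans ha
  -- The coordinates of η lie in [0,1] and equal 1 exactly where |ξ| is maximal, so its powers
  -- converge to the indicator of that finite set, dominated by η.
  let η : KotheSpace (normMatrix f hf) := (((‖ξ a‖ ^ 2)⁻¹ : ℝ) : ℂ) • (star ξ * ξ)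
  have hη : ∀ j, η j = ((‖ξ j‖ ^ 2 / ‖ξ a‖ ^ 2 : ℝ) : ℂ) := fun j => by
    change (((‖ξ a‖ ^ 2)⁻¹ : ℝ) : ℂ) * (conj (ξ j) * ξ j) = _
    rw [mul_comm (conj (ξ j)), Complex.mul_conj, Complex.normSq_eq_norm_sq, ← Complex.ofReal_mul,
      div_eq_inv_mul]
  have hηF : η ∈ F := SMulMemClass.smul_mem _ (mul_mem (star_mem hξ) hξ)
  -- Here `u n` is the power η^{n+1}: the algebra need not have a unit to start from.
  let u : ℕ → KotheSpace (normMatrix f hf) := fun n => Nat.rec η (fun _ v => v * η) n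
  have hu : ∀ n j, u n j = ((‖ξ j‖ ^ 2 / ‖ξ a‖ ^ 2 : ℝ) : ℂ) ^ (n + 1) := fun n j => by
    induction n with
    | zero => rw [zero_add, pow_one]; exact hη j
    | succ n ih =>
      change u n j * η j = _
      rw [ih, hη, pow_succ _ (n + 1)]
  have huF : ∀ n, u n ∈ F := fun n => by
    induction n with
    | zero => exact hηF
    | succ n ih => exact mul_mem ih hηF
  have hfin := finite_setOf_le_norm ξ ha0
  have hmem : ∀ j, j ∈ hfin.toFinset ↔ ‖ξ a‖ ≤ ‖ξ j‖ := fun j => by simp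
  have ht0 : ∀ j, 0 ≤ ‖ξ j‖ ^ 2 / ‖ξ a‖ ^ 2 := fun j => by positivity
  have ht1 : ∀ j ∈ hfin.toFinset, ‖ξ j‖ ^ 2 / ‖ξ a‖ ^ 2 = 1 := fun j hj => by
    rw [le_antisymm (hmax j) ((hmem j).1 hj), div_self (by positivity)]
  have hlt : ∀ j ∉ hfin.toFinset, ‖ξ j‖ ^ 2 / ‖ξ a‖ ^ 2 < 1 := fun j hj => by
    rw [div_lt_one (by positivity)]
    exact pow_lt_pow_left₀ (not_le.1 (mt (hmem j).2 hj)) (norm_nonneg _) two_ne_zero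
  refine ⟨hfin.toFinset, ⟨a, (hmem a).2 le_rfl⟩, ?_, fun j hj => ?_⟩
  · refine hF.mem_of_tendsto (tendsto_of_dominated (u := u) η (fun n j => ?_) fun j => ?_)
      (Eventually.of_forall huF)
    · rw [hu, hη, ind_apply]
      split_ifs with hj
      · rw [ht1 j hj]; simp
      · rw [sub_zero, norm_pow, Complex.norm_real, Real.norm_of_nonneg (ht0 j)]
        exact pow_le_of_le_one (ht0 j) (hlt j hj).le n.succ_ne_zero
    · simp only [hu]
      rw [ind_apply]
      split_ifs with hj
      · rw [ht1 j hj]; simp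
      · refine (tendsto_pow_atTop_nhds_zero_of_norm_lt_one ?_).comp (tendsto_add_atTop_nat 1)
        rw [Complex.norm_real, Real.norm_of_nonneg (ht0 j)]
        exact hlt j hj
  · exact norm_pos_iff.1 (ha0.trans_le ((hmem j).1 hj))

theorem ind_mul_ind_of_subset {A B : Finset ℕ} (h : A ⊆ B) : ind hf A * ind hf B = ind hf A :=
  KotheSpace.ext fun j => by
    rw [KotheSpace.mul_apply, ind_apply, ind_apply]
    by_cases hj : j ∈ A
    · simp [hj, h hj]
    · simp [hj]

theorem subset_of_ind_mul_ind {A B : Finset ℕ} (h : ind hf A * ind hf B = ind hf A) : A ⊆ B := by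
  intro j hj
  have h1 := congrFun (congrArg KotheSpace.toSeq h) j
  rw [KotheSpace.mul_apply, ind_apply, ind_apply, if_pos hj, one_mul] at h1
  by_contra hB
  rw [if_neg hB] at h1
  exact zero_ne_one h1

theorem ind_injective : Function.Injective (ind hf) := fun A B h =>
  (subset_of_ind_mul_ind (hf := hf) (by rw [← h]; exact ind_mul_ind_of_subset subset_rfl)).antisymm
    (subset_of_ind_mul_ind (hf := hf) (by rw [← h]; exact ind_mul_ind_of_subset subset_rfl))

/-- Below the finite set given by `exists_ind_mem`, where ξ has no zeros, there is an
inclusion-minimal nonempty set whose indicator is in F. -/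
theorem exists_isMinimalProjection (hF : IsClosed (F : Set (KotheSpace (normMatrix f hf))))
    {ξ : KotheSpace (normMatrix f hf)} (hξ : ξ ∈ F) (h0 : ξ ≠ 0) :
    ∃ P, IsMinimalProjection F P ∧ ξ * P ≠ 0 := by
  obtain ⟨A, hA, hAF, hAξ⟩ := exists_ind_mem hF hξ h0
  obtain ⟨B, ⟨hBA, hB, hBF⟩, hmin⟩ := wellFounded_lt.has_min
    {B : Finset ℕ | B ⊆ A ∧ B.Nonempty ∧ ind hf B ∈ F} ⟨A, subset_rfl, hA, hAF⟩
  refine ⟨ind hf B, ⟨hBF, isStarProjection_ind B, ind_ne_zero hB, ?_⟩, fun h => ?_⟩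
  · intro Q hQ hQP hQ0 hQB
    obtain ⟨C, rfl⟩ := IsStarProjection.eq_ind hQP
    have hCB : C ⊆ B := subset_of_ind_mul_ind hQB
    have hC : C.Nonempty := by
      rw [Finset.nonempty_iff_ne_empty]
      rintro rfl
      exact hQ0 Finset.sum_empty
    rw [hCB.eq_of_not_ssubset (hmin C ⟨hCB.trans hBA, hC, hQ⟩)]
  · obtain ⟨b, hb⟩ := hB
    have h1 := congrFun (congrArg KotheSpace.toSeq h) b
    rw [KotheSpace.mul_apply, ind_apply, if_pos hb, mul_one, map_zero] at h1
    exact hAξ b (hBA hb) h1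

/-- If P is the indicator of A and a ∈ A, then ξP − ξₐP vanishes at a and off A. Were it nonzero, it
would produce a nonzero projection of F strictly below P. -/
theorem IsMinimalProjection.exists_mul_eq_smul
    (hF : IsClosed (F : Set (KotheSpace (normMatrix f hf))))
    {P ξ : KotheSpace (normMatrix f hf)} (hP : IsMinimalProjection F P) (hξ : ξ ∈ F) :
    ∃ c : ℂ, ξ * P = c • P := by
  obtain ⟨A, rfl⟩ := IsStarProjection.eq_ind hP.isStarProjection
  have hA : A.Nonempty := by
    rw [Finset.nonempty_iff_ne_empty]
    rintro rfl
    exact hP.ne_zero Finset.sum_empty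
  obtain ⟨a, ha⟩ := hA
  refine ⟨ξ a, ?_⟩
  by_contra hne
  obtain ⟨B, hB, hBF, hBζ⟩ := exists_ind_mem hF
    (sub_mem (mul_mem hξ hP.mem) (SMulMemClass.smul_mem (ξ a) hP.mem)) (sub_ne_zero.2 hne)
  have hζ : ∀ j, (ξ * ind hf A - ξ a • ind hf A) j
      = ξ j * (if j ∈ A then 1 else 0) - ξ a * (if j ∈ A then 1 else 0) := fun j => by
    rw [← ind_apply (hf := hf)]; rfl
  have hBA : B ⊆ A := fun j hj => by
    by_contra hjA
    exact hBζ j hj (by rw [hζ, if_neg hjA]; simp)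
  have haB : a ∉ B := fun h => hBζ a h (by rw [hζ, sub_self])
  have := ind_injective (hP.eq_of_le _ hBF (isStarProjection_ind B) (ind_ne_zero hB)
    (ind_mul_ind_of_subset hBA))
  exact haB (this ▸ ha)

/-- A sequence supported in a disjoint union of finite sets is the limit of its restrictions. -/
theorem tendsto_sum_mul_ind {N : ℕ → Finset ℕ} (hN : ∀ k l, k ≠ l → Disjoint (N k) (N l))
    {ξ : KotheSpace (normMatrix f hf)} (hξ : ∀ j, (∀ k, j ∉ N k) → ξ j = 0) :
    Tendsto (fun n => ∑ k ∈ Finset.range n, ξ * ind hf (N k)) atTop (𝓝 ξ) := by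
  have happ : ∀ n j, (∑ k ∈ Finset.range n, ξ * ind hf (N k)) j
      = ∑ k ∈ Finset.range n, ξ j * if j ∈ N k then 1 else 0 := fun n j => by
    rw [map_sum, Finset.sum_apply]
    exact Finset.sum_congr rfl fun k _ => by rw [KotheSpace.mul_apply, ind_apply]
  have hk : ∀ n k j, j ∈ N k → (∑ k ∈ Finset.range n, ξ * ind hf (N k)) j
      = if k < n then ξ j else 0 := fun n k j hj => by
    have hkl : ∀ l, j ∈ N l ↔ l = k := fun l => by
      refine ⟨fun hl => ?_, fun h => h ▸ hj⟩
      by_contra hne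
      exact Finset.disjoint_left.1 (hN l k hne) hl hj
    simp [happ, hkl]
  have h0 : ∀ n j, (∀ k, j ∉ N k) → (∑ k ∈ Finset.range n, ξ * ind hf (N k)) j = 0 :=
    fun n j hj => by simp [happ, hj]
  refine tendsto_of_dominated ξ (fun n j => ?_) fun j => ?_
  · by_cases hj : ∃ k, j ∈ N k
    · obtain ⟨k, hj⟩ := hj
      rw [hk n k j hj]
      split_ifs <;> simp
    · push Not at hj
      rw [h0 n j hj, hξ j hj, sub_zero]
  · by_cases hj : ∃ k, j ∈ N k
    · obtain ⟨k, hj⟩ := hj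
      refine tendsto_const_nhds.congr' ?_
      filter_upwards [eventually_gt_atTop k] with n hn
      rw [hk n k j hj, if_pos hn]
    · push Not at hj
      simp only [h0 _ j hj, hξ j hj, tendsto_const_nhds]

end Projections

/-! ### Isomorphisms -/

section Iso

variable {f : ℕ → S} (hf : OrthonormalSeq f)
  {E : NonUnitalStarSubalgebra ℂ (SDual →L[ℂ] S)}
  {F : NonUnitalStarSubalgebra ℂ (KotheSpace (normMatrix f hf))}

/-- If `F` is the preimage of `E` under `ξ ↦ ∑ⱼ ξⱼ ⟨·, fⱼ⟩ fⱼ` and `E` is contained in the range of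
this map, then the map restricts to an isomorphism of Fréchet `*`-algebras. -/
theorem exists_iso_of_mem_iff (hEF : ∀ ξ, ξ ∈ F ↔ diag hf ξ ∈ E)
    (hE : (E : Set (SDual →L[ℂ] S)) ⊆ Set.range (diag hf)) :
    ∃ Φ : E ≃⋆ₐ[ℂ] F, Continuous Φ ∧ Continuous Φ.symm ∧
      ∀ (ξ : KotheSpace (normMatrix f hf)) (h : diag hf ξ ∈ E), (Φ ⟨diag hf ξ, h⟩).1 = ξ := by
  let e : F → E := fun ξ => ⟨diag hf ξ, (hEF ξ).1 ξ.2⟩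
  have he : Function.Bijective e := by
    refine ⟨fun ξ ζ h => Subtype.ext (diag_injective hf (congrArg Subtype.val h)), fun x => ?_⟩
    obtain ⟨ξ, hξ⟩ := hE x.2
    exact ⟨⟨ξ, (hEF ξ).2 (hξ ▸ x.2)⟩, Subtype.ext hξ⟩
  let Ψ : F ≃⋆ₐ[ℂ] E :=
    { Equiv.ofBijective e he with
      map_mul' := fun ξ ζ => Subtype.ext (diag_mul hf ξ ζ)
      map_add' := fun ξ ζ => Subtype.ext (map_add (diag hf) ξ.1 ζ.1)
      map_star' := fun ξ => Subtype.ext (diag_star hf ξ)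
      map_smul' := fun c ξ => Subtype.ext (map_smul (diag hf) c ξ.1) }
  have hΨ : ∀ ξ : F, (Ψ ξ : SDual →L[ℂ] S) = diag hf ξ := fun ξ => rfl
  refine ⟨Ψ.symm, ?_, ?_, fun ξ h => ?_⟩
  -- Continuity into F is tested after applying `diag hf`, where the composite is the inclusion of
  -- E.
  · refine (((isClosedEmbedding_diag hf).isInducing.comp
      Topology.IsInducing.subtypeVal).continuous_iff).2 ?_
    refine continuous_subtype_val.congr fun x => ?_
    rw [Function.comp_apply, Function.comp_apply, ← hΨ, StarAlgEquiv.apply_symm_apply]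
  · exact ((continuous_diag hf).comp continuous_subtype_val).subtype_mk _
  · refine diag_injective hf ?_
    rw [← hΨ, StarAlgEquiv.apply_symm_apply]

end Iso

/-! ### Minimal projections of closed commutative *-subalgebras of L(s',s). -/

section Structure

variable {E : NonUnitalStarSubalgebra ℂ (SDual →L[ℂ] S)}

theorem isStarProjection_diag_iff {f : ℕ → S} (hf : OrthonormalSeq f)
    (ξ : KotheSpace (normMatrix f hf)) :
    IsStarProjection (diag hf ξ) ↔ IsStarProjection ξ := by
  rw [isStarProjection_iff, isStarProjection_iff, IsIdempotentElem, IsIdempotentElem,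
    isSelfAdjoint_iff, isSelfAdjoint_iff, ← diag_mul, ← diag_star, (diag_injective hf).eq_iff,
    (diag_injective hf).eq_iff]

theorem isMinimalProjection_diag_iff {f : ℕ → S} (hf : OrthonormalSeq f)
    (hEr : (E : Set (SDual →L[ℂ] S)) ⊆ Set.range (diag hf))
    (ξ : KotheSpace (normMatrix f hf)) :
    IsMinimalProjection E (diag hf ξ) ↔ IsMinimalProjection (E.comap (diagHom hf)) ξ := by
  constructor
  · rintro ⟨h1, h2, h3, h4⟩
    refine ⟨h1, (isStarProjection_diag_iff hf ξ).1 h2, fun h => h3 (by rw [h, map_zero]), ?_⟩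
    intro Q hQ hQp hQ0 hQξ
    refine diag_injective hf (h4 _ hQ ((isStarProjection_diag_iff hf Q).2 hQp)
      (fun h => hQ0 (diag_injective hf (h.trans (map_zero _).symm))) ?_)
    rw [← diag_mul, hQξ]
  · rintro ⟨h1, h2, h3, h4⟩
    refine ⟨h1, (isStarProjection_diag_iff hf ξ).2 h2,
      fun h => h3 (diag_injective hf (h.trans (map_zero _).symm)), ?_⟩
    intro Q hQ hQp hQ0 hQξ
    obtain ⟨ζ, rfl⟩ := hEr hQ
    rw [← diag_mul] at hQξ
    rw [h4 ζ hQ ((isStarProjection_diag_iff hf ζ).1 hQp) (fun h => hQ0 (by rw [h, map_zero]))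
      (diag_injective hf hQξ)]

theorem isClosed_comap_diagHom (hEc : IsClosed (E : Set (SDual →L[ℂ] S))) {f : ℕ → S}
    (hf : OrthonormalSeq f) :
    IsClosed (E.comap (diagHom hf) : Set (KotheSpace (normMatrix f hf))) :=
  hEc.preimage (continuous_diag hf)

/-- The statement mentions no orthonormal sequence, so any diagonalizing one may be used to transfer
the question to λ^∞. -/
theorem exists_isMinimalProjection_mul_ne_zero
    (hEc : IsClosed (E : Set (SDual →L[ℂ] S))) (hE : ∀ x ∈ E, ∀ y ∈ E, x * y = y * x)
    {x : SDual →L[ℂ] S} (hx : x ∈ E) (h0 : x ≠ 0) :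
    ∃ P, IsMinimalProjection E P ∧ x * P ≠ 0 := by
  obtain ⟨f, hf, hEr⟩ := exists_subset_range_diag hE
  obtain ⟨ξ, rfl⟩ := hEr hx
  obtain ⟨P, hP, hPξ⟩ := exists_isMinimalProjection (F := E.comap (diagHom hf))
    (isClosed_comap_diagHom hEc hf) (ξ := ξ) hx (fun h => h0 (by rw [h, map_zero]))
  refine ⟨diag hf P, (isMinimalProjection_diag_iff hf hEr P).2 hP, fun h => hPξ ?_⟩
  rw [← diag_mul] at h
  exact diag_injective hf (h.trans (map_zero _).symm)

theorem exists_mul_eq_smul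
    (hEc : IsClosed (E : Set (SDual →L[ℂ] S))) (hE : ∀ x ∈ E, ∀ y ∈ E, x * y = y * x)
    {x P : SDual →L[ℂ] S} (hx : x ∈ E) (hP : IsMinimalProjection E P) :
    ∃ c : ℂ, x * P = c • P := by
  obtain ⟨f, hf, hEr⟩ := exists_subset_range_diag hE
  obtain ⟨ξ, rfl⟩ := hEr hx
  obtain ⟨p, rfl⟩ := hEr hP.mem
  obtain ⟨c, hc⟩ := IsMinimalProjection.exists_mul_eq_smul (isClosed_comap_diagHom hEc hf)
    ((isMinimalProjection_diag_iff hf hEr p).1 hP) (ξ := ξ) hx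
  exact ⟨c, by rw [← diag_mul, hc, map_smul]⟩

end Structure

/-! ### Expansion along a given canonical Schauder basis. -/

section Basis

variable {f : ℕ → S} {hf : OrthonormalSeq f}

theorem diag_ind (A : Finset ℕ) : diag hf (ind hf A) = ∑ j ∈ A, rankOne (f j) := by
  rw [ind, map_sum]
  exact Finset.sum_congr rfl fun j _ => diag_unit hf j

/-- Expansion of an operator with respect to the canonical Schauder basis. -/
theorem exists_diag_eq {E : NonUnitalStarSubalgebra ℂ (SDual →L[ℂ] S)}
    (hEc : IsClosed (E : Set (SDual →L[ℂ] S))) (hE : ∀ x ∈ E, ∀ y ∈ E, x * y = y * x)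
    {N : ℕ → Finset ℕ} (hN : ∀ k l, k ≠ l → Disjoint (N k) (N l))
    (hb : IsCanonicalBasis E fun k => ∑ j ∈ N k, rankOne (f j))
    {x : SDual →L[ℂ] S} (hx : x ∈ E) :
    ∃ (ξ : KotheSpace (normMatrix f hf)) (c : ℕ → ℂ), diag hf ξ = x ∧
      (∀ k, ξ * ind hf (N k) = c k • ind hf (N k)) ∧ ∀ j, (∀ k, j ∉ N k) → ξ j = 0 := by
  have hmin : ∀ k, IsMinimalProjection E (∑ j ∈ N k, rankOne (f j)) := fun k => by
    have : (fun k => ∑ j ∈ N k, rankOne (f j)) k ∈ {Q | IsMinimalProjection E Q} :=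
      hb.range_eq ▸ Set.mem_range_self k
    exact this
  choose c hc using fun k => exists_mul_eq_smul hEc hE hx (hmin k)
  have heig : ∀ k, ∀ j ∈ N k, x (incl (f j)) = c k • f j := fun k j hj => by
    have h1 := DFunLike.congr_fun (hc k) (incl (f j))
    rw [← diag_ind (hf := hf), mul_apply, smul_apply, diag_apply_self, ind_apply, if_pos hj,
      one_smul] at h1
    exact h1
  classical
  -- The sequence equals c_k on N_k, unambiguously by disjointness, and 0 off all the N_k.
  let a : ℕ → ℂ := fun j => if h : ∃ k, j ∈ N k then c h.choose else 0
  have ha : ∀ k, ∀ j ∈ N k, a j = c k := fun k j hj => by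
    have h : ∃ k, j ∈ N k := ⟨k, hj⟩
    have : h.choose = k := by
      by_contra hne
      exact Finset.disjoint_left.1 (hN _ _ hne) h.choose_spec hj
    change (if h : ∃ k, j ∈ N k then c h.choose else 0) = _
    rw [dif_pos h, this]
  have ha0 : ∀ j, (∀ k, j ∉ N k) → a j = 0 := fun j hj => dif_neg (not_exists.2 hj)
  let ξ : KotheSpace (normMatrix f hf) := KotheSpace.mk a <|
    bddAbove_eigenvalues hf (x := x) fun j => by
      by_cases h : ∃ k, j ∈ N k
      · obtain ⟨k, hk⟩ := h
        exact Or.inr (by rw [ha k j hk]; exact heig k j hk)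
      · exact Or.inl (ha0 j (not_exists.1 h))
  have hξN : ∀ k, ξ * ind hf (N k) = c k • ind hf (N k) := fun k => KotheSpace.ext fun j => by
    change a j * ind hf (N k) j = c k * ind hf (N k) j
    rw [ind_apply]
    split_ifs with hj
    · rw [ha k j hj]
    · rw [mul_zero, mul_zero]
  -- The operator is the limit of the partial sums of ∑ c_k P_k, with P_k the basis projections, by
  -- dominated convergence in λ^∞ and continuity of `diag`.
  have hξE : diag hf ξ ∈ E := by
    refine hEc.mem_of_tendsto (((continuous_diag hf).tendsto ξ).comp
      (tendsto_sum_mul_ind hN (ξ := ξ) ha0)) (Filter.Eventually.of_forall fun n => ?_)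
    rw [Function.comp_apply, map_sum]
    refine sum_mem fun k _ => ?_
    rw [hξN, map_smul, diag_ind]
    exact SMulMemClass.smul_mem _ (hmin k).mem
  refine ⟨ξ, c, ?_, hξN, ha0⟩
  -- The difference `diag hf ξ - x` lies in E and is annihilated by every P_k, hence by every
  -- minimal projection of E, so it must vanish.
  by_contra hne
  obtain ⟨P, hP, hPne⟩ := exists_isMinimalProjection_mul_ne_zero hEc hE (sub_mem hξE hx)
    (sub_ne_zero.2 hne)
  obtain ⟨k, rfl⟩ : P ∈ Set.range fun k => ∑ j ∈ N k, rankOne (f j) := hb.range_eq ▸ hP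
  refine hPne ?_
  beta_reduce
  rw [sub_mul, hc k, ← diag_ind (hf := hf), ← diag_mul, hξN, map_smul, sub_self]

/-- The preimage of E is a closed *-subalgebra containing the generators. Conversely, each of its
elements is a limit of linear combinations of them by `exists_diag_eq`. -/
theorem mem_closedAdjoin_iff {E : NonUnitalStarSubalgebra ℂ (SDual →L[ℂ] S)}
    (hEc : IsClosed (E : Set (SDual →L[ℂ] S))) (hE : ∀ x ∈ E, ∀ y ∈ E, x * y = y * x)
    {N : ℕ → Finset ℕ} (hN : ∀ k l, k ≠ l → Disjoint (N k) (N l))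
    (hb : IsCanonicalBasis E fun k => ∑ j ∈ N k, rankOne (f j))
    (ξ : KotheSpace (normMatrix f hf)) :
    ξ ∈ closedAdjoin (Set.range fun k => ind hf (N k)) ↔ diag hf ξ ∈ E := by
  constructor
  · intro h
    have hle : closedAdjoin (Set.range fun k => ind hf (N k)) ≤ E.comap (diagHom hf) := by
      refine sInf_le ⟨isClosed_comap_diagHom hEc hf, ?_⟩
      rintro _ ⟨k, rfl⟩
      change diag hf (ind hf (N k)) ∈ E
      rw [diag_ind]
      exact hb.mem k
    exact hle h
  · intro h
    obtain ⟨ζ, c, hζ, hζN, hζ0⟩ := exists_diag_eq (hf := hf) hEc hE hN hb h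
    obtain rfl := diag_injective hf hζ
    rw [closedAdjoin, NonUnitalStarAlgebra.mem_sInf]
    rintro F ⟨hFc, hF⟩
    refine hFc.mem_of_tendsto (tendsto_sum_mul_ind hN hζ0) (Filter.Eventually.of_forall fun n => ?_)
    refine sum_mem fun k _ => ?_
    rw [hζN]
    exact SMulMemClass.smul_mem _ (hF ⟨k, rfl⟩)

end Basis

end SmoothOp

end

/-! ### Assembly of the three statements. -/

theorem mainTheorem4 :
    -- every closed commutative `*`-subalgebra of `L(s', s)`
    (∀ E : NonUnitalStarSubalgebra ℂ (SmoothOp.SDual →L[ℂ] SmoothOp.S),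
      IsClosed (E : Set (SmoothOp.SDual →L[ℂ] SmoothOp.S)) →
      (∀ x ∈ E, ∀ y ∈ E, x * y = y * x) →
      ∃ (f : ℕ → SmoothOp.S) (hf : SmoothOp.OrthonormalSeq f)
        (F : NonUnitalStarSubalgebra ℂ (SmoothOp.KotheSpace (SmoothOp.normMatrix f hf))),
        IsClosed (F : Set (SmoothOp.KotheSpace (SmoothOp.normMatrix f hf))) ∧
        SmoothOp.FrechetIso E F) ∧
    -- the explicit form for infinite-dimensional algebras
    (∀ E : NonUnitalStarSubalgebra ℂ (SmoothOp.SDual →L[ℂ] SmoothOp.S),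
      IsClosed (E : Set (SmoothOp.SDual →L[ℂ] SmoothOp.S)) →
      (∀ x ∈ E, ∀ y ∈ E, x * y = y * x) →
      ¬ FiniteDimensional ℂ E →
      ∀ (f : ℕ → SmoothOp.S) (hf : SmoothOp.OrthonormalSeq f) (N : ℕ → Finset ℕ),
        (∀ k l, k ≠ l → Disjoint (N k) (N l)) →
        ∀ hE : SmoothOp.IsCanonicalBasis E
          (fun k => ∑ j ∈ N k, SmoothOp.rankOne (f j)),
        ∃ Φ : E ≃⋆ₐ[ℂ] (SmoothOp.closedAdjoin (Set.range fun k =>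
            ∑ j ∈ N k, SmoothOp.KotheSpace.unit (SmoothOp.normMatrix f hf) j)),
          Continuous Φ ∧ Continuous Φ.symm ∧
          ∀ k, (Φ ⟨∑ j ∈ N k, SmoothOp.rankOne (f j), hE.mem k⟩ :
              SmoothOp.KotheSpace (SmoothOp.normMatrix f hf)) =
            ∑ j ∈ N k, SmoothOp.KotheSpace.unit (SmoothOp.normMatrix f hf) j) ∧
    -- the converse
    (∀ (f : ℕ → SmoothOp.S) (hf : SmoothOp.OrthonormalSeq f)
      (F : NonUnitalStarSubalgebra ℂ (SmoothOp.KotheSpace (SmoothOp.normMatrix f hf))),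
      IsClosed (F : Set (SmoothOp.KotheSpace (SmoothOp.normMatrix f hf))) →
      ∃ E : NonUnitalStarSubalgebra ℂ (SmoothOp.SDual →L[ℂ] SmoothOp.S),
        IsClosed (E : Set (SmoothOp.SDual →L[ℂ] SmoothOp.S)) ∧
        (∀ x ∈ E, ∀ y ∈ E, x * y = y * x) ∧
        SmoothOp.FrechetIso E F) := by
  refine ⟨fun E hEc hE => ?_, fun E hEc hE _ f hf N hN hb => ?_, fun f hf F hF => ?_⟩
  · obtain ⟨f, hf, hEr⟩ := SmoothOp.exists_subset_range_diag hE
    obtain ⟨Φ, h1, h2, -⟩ := SmoothOp.exists_iso_of_mem_iff hf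
      (F := E.comap (SmoothOp.diagHom hf)) (fun _ => Iff.rfl) hEr
    exact ⟨f, hf, E.comap (SmoothOp.diagHom hf), SmoothOp.isClosed_comap_diagHom hEc hf, Φ, h1, h2⟩
  · obtain ⟨Φ, h1, h2, h3⟩ := SmoothOp.exists_iso_of_mem_iff hf
      (SmoothOp.mem_closedAdjoin_iff (hf := hf) hEc hE hN hb) (fun x hx => by
        obtain ⟨ξ, -, hξ, -⟩ := SmoothOp.exists_diag_eq (hf := hf) hEc hE hN hb hx
        exact ⟨ξ, hξ⟩)
    refine ⟨Φ, h1, h2, fun k => ?_⟩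
    have h4 := h3 (SmoothOp.ind hf (N k)) (by rw [SmoothOp.diag_ind]; exact hb.mem k)
    simp only [SmoothOp.diag_ind] at h4
    exact h4
  -- The required algebra is the image of F; it is closed because `diag` is a closed embedding.
  · have hmem : ∀ ξ, ξ ∈ F ↔ SmoothOp.diag hf ξ ∈ F.map (SmoothOp.diagHom hf) := fun ξ => by
      refine ⟨fun h => ⟨ξ, h, rfl⟩, ?_⟩
      rintro ⟨ζ, hζ, h⟩
      exact SmoothOp.diag_injective hf h ▸ hζ
    obtain ⟨Φ, h1, h2, -⟩ := SmoothOp.exists_iso_of_mem_iff hf hmem (by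
      rintro _ ⟨ζ, -, rfl⟩
      exact ⟨ζ, rfl⟩)
    refine ⟨F.map (SmoothOp.diagHom hf), (SmoothOp.isClosedEmbedding_diag hf).isClosedMap _ hF, ?_,
      Φ, h1, h2⟩
    rintro _ ⟨ξ, -, rfl⟩ _ ⟨ζ, -, rfl⟩
    change SmoothOp.diagHom hf ξ * SmoothOp.diagHom hf ζ
      = SmoothOp.diagHom hf ζ * SmoothOp.diagHom hf ξ
    rw [← map_mul, ← map_mul, mul_comm]
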